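/- All graphs are finite and simple. In a graph $G$, a leaf is a vertex of degree $1$ and a support vertex is a vertex adjacent to a leaf. A set $D\subseteq V(G)$ is a disjunctive dominating set if every vertex not in $D$ is adjacent to a vertex of $D$ or has at least two vertices of $D$ at distance exactly $2$ from it; $\gamma_2^d(G)$ is the minimum cardinality of such a set. A labeling $S$ of a tree $T$ assigns to each vertex $v$ a status $\mathrm{sta}(v)\in\{A,B,C,D\}$. Let $\mathscr T_2$ be the smallest family of labeled trees $(T,S)$ (up to isomorphism) that contains the path $P_4$ whose two leaves have status $C$ and whose two other vertices have status $A$, and that is closed under the operations $\mathscr O_2,\mathscr O_3,\mathscr O_4$ below. The basic path of a member of $\mathscr T_2$ is the copy in it of the initial $P_4$ from which it was built. If $v\,v_1v_2\,u$ is an induced path of $T$ with $\mathrm{sta}(v)=A$, $\mathrm{sta}(v_1)=C$, $\mathrm{sta}(v_2)=D$, $\mathrm{sta}(u)=B$, then $v$ is called a corresponding vertex of $u$; if moreover $v$ is not a support vertex and is not on the basic path, then $u$ is called a corresponding vertex of $v$. - $\mathscr O_2$: let $v$ be a vertex of status $B$ that has a corresponding vertex of degree two; add a new path $u_1u_2$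 and the edge $u_1v$, with $\mathrm{sta}(u_1)=A$, $\mathrm{sta}(u_2)=C$. - $\mathscr O_3$: let $v$ be a vertex of status $C$ and degree one; add a new path $u_1u_2u_3u_4$ and the edge $u_1v$, with $\mathrm{sta}(u_1)=D$, $\mathrm{sta}(u_2)=B$, $\mathrm{sta}(u_3)=A$, $\mathrm{sta}(u_4)=C$. - $\mathscr O_4$: let $v$ be a vertex of status $A$ that is not on the basic path and has a corresponding vertex of degree two; add a new path $u_1u_2$ and the edge $u_1v$, with $\mathrm{sta}(u_1)=A$, $\mathrm{sta}(u_2)=C$. **Theorem.** Let $T$ be a tree with $n\ge 2$ vertices, $l$ leaves and $s$ support vertices. Then $$\gamma_2^d(T)\le \frac{n+l+s}{4},$$ with equality if and only if $(T,S)\in\mathscr T_2$ for some labeling $S$ of $T$. -/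

import Mathlib

namespace DisjDom

universe u

/-- The four labels a vertex of a labeled tree can carry. A labeling of a tree on `V`, i.e. a weak
partition `(S_A, S_B, S_C, S_D)` of `V`, is a function `V → Status`. -/
inductive Status : Type
  | A | B | C | D

/-- The number of neighbours of `v`. -/
noncomputable def deg {V : Type u} (G : SimpleGraph V) (v : V) : ℕ :=
  (G.neighborSet v).ncard

/-- A leaf is a vertex of degree one. -/
def IsLeaf {V : Type u} (G : SimpleGraph V) (v : V) : Prop :=
  deg G v = 1

/-- A support vertex is a vertex adjacent to a leaf. -/
def IsSupport {V : Type u} (G : SimpleGraph V) (v : V) : Prop :=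
  ∃ w, G.Adj v w ∧ IsLeaf G w

/-- `l(G)`. -/
noncomputable def numLeaves {V : Type u} (G : SimpleGraph V) : ℕ :=
  {v | IsLeaf G v}.ncard

/-- `s(G)`. -/
noncomputable def numSupports {V : Type u} (G : SimpleGraph V) : ℕ :=
  {v | IsSupport G v}.ncard

/-- `D` is a disjunctive dominating set: every vertex outside `D` is adjacent to a vertex of `D` or
has at least two vertices of `D` at distance two from it. -/
def IsDisjDominating {V : Type u} (G : SimpleGraph V) (D : Finset V) : Prop :=
  ∀ v, v ∉ D → (∃ w ∈ D, G.Adj v w) ∨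
    ∃ a ∈ D, ∃ b ∈ D, a ≠ b ∧ G.dist v a = 2 ∧ G.dist v b = 2

/-- The disjunctive domination number; on a finite vertex set the set of cardinalities is nonempty,
as the set of all vertices is disjunctive dominating. -/
noncomputable def disjDomNumber {V : Type u} (G : SimpleGraph V) : ℕ :=
  sInf {k | ∃ D : Finset V, IsDisjDominating G D ∧ D.card = k}

/-- Add to `G` a new path with `k` vertices `u₀ u₁ ⋯ u_{k-1}` and the edge `u₀v`. -/
def attachPath {V : Type u} (G : SimpleGraph V) (v : V) (k : ℕ) : SimpleGraph (V ⊕ Fin k) where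
  Adj
    | .inl a, .inl b => G.Adj a b
    | .inr i, .inr j => (SimpleGraph.pathGraph k).Adj i j
    | .inl a, .inr i => a = v ∧ i.val = 0
    | .inr i, .inl a => a = v ∧ i.val = 0
  symm := ⟨by
    rintro (a | i) (b | j) h
    · exact G.adj_symm h
    · exact h
    · exact h
    · exact (SimpleGraph.pathGraph k).adj_symm h⟩
  loopless := ⟨by
    rintro (a | i) h
    · exact G.irrefl h
    · exact (SimpleGraph.pathGraph k).irrefl h⟩

/-- `u` is a corresponding vertex of the vertex `v` of status `A`, where `P` is the vertex set of
the basic path: `v` is neither a support vertex nor on the basic path, and there is an induced path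
`v v₁ v₂ u` with statuses `A, C, D, B`. -/
def CorrespondsToA {V : Type u} (G : SimpleGraph V) (S : V → Status) (P : Set V) (v u : V) :
    Prop :=
  ¬ IsSupport G v ∧ v ∉ P ∧ S v = .A ∧
    ∃ f : SimpleGraph.pathGraph 4 ↪g G,
      f 0 = v ∧ f 3 = u ∧ S (f 1) = .C ∧ S (f 2) = .D ∧ S u = .B

/-- `v` is a corresponding vertex of the vertex `u` of status `B`: there is an induced path
`v v₁ v₂ u` with statuses `A, C, D, B`. -/
def CorrespondsToB {V : Type u} (G : SimpleGraph V) (S : V → Status) (u v : V) : Prop :=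
  S u = .B ∧
    ∃ f : SimpleGraph.pathGraph 4 ↪g G,
      f 0 = v ∧ f 3 = u ∧ S v = .A ∧ S (f 1) = .C ∧ S (f 2) = .D

/-- `Generated G S P`: the labeled graph `(G, S)` is obtained from the labeled path `P₄` with
statuses `C, A, A, C` by a finite sequence of the operations `op2`, `op3`, `op4`, and `P` is the
vertex set of the copy of that initial path (the basic path). Labeled graphs are taken up to
isomorphism. -/
inductive Generated :
    {V : Type u} → SimpleGraph V → (V → Status) → Set V → Prop
  | base {V : Type u} (G : SimpleGraph V) (e : SimpleGraph.pathGraph 4 ≃g G) :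
      Generated G (fun v => ![Status.C, .A, .A, .C] (e.symm v)) Set.univ
  | op2 {V : Type u} {G : SimpleGraph V} {S : V → Status} {P : Set V} (v : V) :
      Generated G S P → S v = .B → (∃ w, CorrespondsToB G S v w ∧ deg G w = 2) →
      Generated (attachPath G v 2) (Sum.elim S ![Status.A, .C]) (Sum.inl '' P)
  | op3 {V : Type u} {G : SimpleGraph V} {S : V → Status} {P : Set V} (v : V) :
      Generated G S P → S v = .C → deg G v = 1 →
      Generated (attachPath G v 4) (Sum.elim S ![Status.D, .B, .A, .C]) (Sum.inl '' P)
  | op4 {V : Type u} {G : SimpleGraph V} {S : V → Status} {P : Set V} (v : V) :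
      Generated G S P → v ∉ P → S v = .A → (∃ w, CorrespondsToA G S P v w ∧ deg G w = 2) →
      Generated (attachPath G v 2) (Sum.elim S ![Status.A, .C]) (Sum.inl '' P)
  | iso {V W : Type u} {G : SimpleGraph V} {H : SimpleGraph W} {S : V → Status} {P : Set V}
      (e : G ≃g H) :
      Generated G S P → Generated H (fun w => S (e.symm w)) (e '' P)

/-- Membership of the labeled graph `(G, S)` in the family `𝒯₂`. -/
def FamilyT2 {V : Type u} (G : SimpleGraph V) (S : V → Status) : Prop :=
  ∃ P : Set V, Generated G S P

end DisjDom

/-! Call a set `E` an *end set* of a graph if it cuts the graph into edges `e c`, with `c` a leaf,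
and paths `e c d e'`, where the *ends* `e`, `e'` belong to `E` and the other vertices do not, such
that every end is adjacent to an end of another piece. The weight `n + l + s` of a tree with an end
set is four times the number of pieces.

The bound is proved by induction, removing pendant paths next to the bottom of a longest path.
Equality forces an end set: the only reductions without loss remove two vertices attached at an end
or four vertices attached at a leaf, that is, they remove one piece.

Given an end set, the ends lying above their mates in a rooted tree almost dominate. If no end of
some piece has at most one neighbour in other pieces, rooting the tree in that piece saves a vertex,
so equality forces every piece to have such a *small* end. Conversely, the vertex next to a small
end can only be dominated from inside the piece, so if every piece has a small end, then every
dominating set meets every piece.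

Finally, in a tree whose pieces all have small ends one finds two adjacent small ends. They and
the vertices next to them inside their pieces form the initial `P₄`, from which the whole tree is
grown, by `𝒪₂` or `𝒪₄` at an end that is not small and by `𝒪₃` to complete a path `e c d e'` of
which only `e c` is present. -/

namespace DisjDom

universe u

/-! ### Domination and weight -/

section

variable {V W : Type*} {G : SimpleGraph V} {H : SimpleGraph W}

/-- `v` is disjunctively dominated by the set `D`. In place of distance two only a walk of length
two is required: this is equivalent as soon as every vertex is dominated, and it is preserved by
injective homomorphisms. -/
def Dominated (G : SimpleGraph V) (D : Set V) (v : V) : Prop :=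
  v ∈ D ∨ (∃ w ∈ D, G.Adj v w) ∨
    ∃ a ∈ D, ∃ b ∈ D, a ≠ b ∧ (∃ x, G.Adj v x ∧ G.Adj x a) ∧ ∃ y, G.Adj v y ∧ G.Adj y b

theorem dist_eq_two_of_adj_of_adj {v x a : V} (hne : v ≠ a) (hna : ¬ G.Adj v a)
    (hvx : G.Adj v x) (hxa : G.Adj x a) : G.dist v a = 2 := by
  have h : G.edist v a = 2 := SimpleGraph.edist_eq_two_iff.2
    ⟨hne, hna, x, SimpleGraph.mem_commonNeighbors _ |>.2 ⟨hvx, hxa.symm⟩⟩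
  simp [SimpleGraph.dist, h]

theorem exists_adj_adj_of_dist_eq_two {v a : V} (h : G.dist v a = 2) :
    ∃ x, G.Adj v x ∧ G.Adj x a := by
  have hr : G.Reachable v a := SimpleGraph.Reachable.of_dist_ne_zero (by omega)
  have he : G.edist v a = 2 := by rw [← hr.coe_dist_eq_edist, h]; rfl
  obtain ⟨x, hx⟩ := (SimpleGraph.edist_eq_two_iff.1 he).2.2
  rw [SimpleGraph.mem_commonNeighbors] at hx
  exact ⟨x, hx.1, hx.2.symm⟩

theorem isDisjDominating_iff {D : Finset V} :
    IsDisjDominating G D ↔ ∀ v, Dominated G (D : Set V) v := by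
  constructor
  · intro h v
    by_cases hv : v ∈ D
    · exact Or.inl hv
    rcases h v hv with h | ⟨a, ha, b, hb, hab, hva, hvb⟩
    · exact Or.inr (Or.inl h)
    · exact Or.inr (Or.inr ⟨a, ha, b, hb, hab, exists_adj_adj_of_dist_eq_two hva,
        exists_adj_adj_of_dist_eq_two hvb⟩)
  · intro h v hv
    rcases h v with h | h | ⟨a, ha, b, hb, hab, ⟨x, hvx, hxa⟩, y, hvy, hyb⟩
    · exact absurd h hv
    · exact Or.inl h
    · by_cases hva : G.Adj v a
      · exact Or.inl ⟨a, ha, hva⟩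
      by_cases hvb : G.Adj v b
      · exact Or.inl ⟨b, hb, hvb⟩
      have hne {c : V} (hc : c ∈ D) : v ≠ c := fun h => hv (h ▸ hc)
      exact Or.inr ⟨a, ha, b, hb, hab, dist_eq_two_of_adj_of_adj (hne ha) hva hvx hxa,
        dist_eq_two_of_adj_of_adj (hne hb) hvb hvy hyb⟩

theorem disjDomNumber_le_ncard [Finite V] {D : Set V} (h : ∀ v, Dominated G D v) :
    disjDomNumber G ≤ D.ncard :=
  Nat.sInf_le ⟨D.toFinite.toFinset, isDisjDominating_iff.2 (by simpa using h),
    (Set.ncard_eq_toFinset_card D).symm⟩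

theorem exists_dominating_ncard_eq [Finite V] (G : SimpleGraph V) :
    ∃ D : Set V, (∀ v, Dominated G D v) ∧ D.ncard = disjDomNumber G := by
  have hne : {k | ∃ D : Finset V, IsDisjDominating G D ∧ D.card = k}.Nonempty :=
    ⟨_, (Set.toFinite Set.univ).toFinset,
      isDisjDominating_iff.2 fun v => Or.inl (by simp), rfl⟩
  obtain ⟨D, hD, hc⟩ := Nat.sInf_mem hne
  exact ⟨D, isDisjDominating_iff.1 hD, by rw [Set.ncard_coe_finset]; exact hc⟩

theorem Dominated.map (f : G →g H) (hf : Function.Injective f) {D : Set V} {D' : Set W}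
    (hD : Set.MapsTo f D D') {v : V} (h : Dominated G D v) : Dominated H D' (f v) := by
  rcases h with h | ⟨w, hw, h⟩ | ⟨a, ha, b, hb, hab, ⟨x, hx, hxa⟩, y, hy, hyb⟩
  · exact Or.inl (hD h)
  · exact Or.inr (Or.inl ⟨_, hD hw, f.map_adj h⟩)
  · exact Or.inr (Or.inr ⟨_, hD ha, _, hD hb, hf.ne hab,
      ⟨_, f.map_adj hx, f.map_adj hxa⟩, _, f.map_adj hy, f.map_adj hyb⟩)

theorem isLeaf_iff {v : V} : IsLeaf G v ↔ ∃! w, G.Adj v w := by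
  simp [IsLeaf, deg, Set.ncard_eq_one, Set.eq_singleton_iff_unique_mem, ExistsUnique]

/-- The order plus the number of leaves plus the number of support vertices. -/
noncomputable def weight (G : SimpleGraph V) : ℕ :=
  Nat.card V + numLeaves G + numSupports G

theorem isLeaf_apply_iff (e : G ≃g H) {v : V} : IsLeaf H (e v) ↔ IsLeaf G v := by
  simp only [isLeaf_iff, e.bijective.existsUnique_iff, e.map_adj_iff]

theorem isSupport_apply_iff (e : G ≃g H) {v : V} : IsSupport H (e v) ↔ IsSupport G v := by
  simp only [IsSupport, e.surjective.exists, e.map_adj_iff, isLeaf_apply_iff e]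

theorem weight_congr (e : G ≃g H) : weight G = weight H := by
  have ncard_eq {p : V → Prop} {q : W → Prop} (hpq : ∀ v, q (e v) ↔ p v) :
      {v | p v}.ncard = {w | q w}.ncard := by
    have : {v | p v} = e ⁻¹' {w | q w} := Set.ext fun v => (hpq v).symm
    rw [this, Set.ncard_preimage_of_injective_subset_range e.injective]
    simp [e.surjective.range_eq]
  rw [weight, weight, numLeaves, numSupports, numLeaves, numSupports, Nat.card_congr e.toEquiv,
    ncard_eq fun _ => isLeaf_apply_iff e, ncard_eq fun _ => isSupport_apply_iff e]

theorem dominated_image (e : G ≃g H) {D : Set V} (hD : ∀ v, Dominated G D v) (w : W) :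
    Dominated H (e '' D) w := by
  obtain ⟨v, rfl⟩ := e.surjective w
  exact (hD v).map e.toHom e.injective (Set.mapsTo_image e D)

theorem disjDomNumber_congr [Finite V] (e : G ≃g H) : disjDomNumber G = disjDomNumber H := by
  have := Finite.of_equiv V e.toEquiv
  apply le_antisymm
  · obtain ⟨D, hD, hc⟩ := exists_dominating_ncard_eq H
    rw [← hc, ← Set.ncard_image_of_injective D e.symm.injective]
    exact disjDomNumber_le_ncard (dominated_image e.symm hD)
  · obtain ⟨D, hD, hc⟩ := exists_dominating_ncard_eq G
    rw [← hc, ← Set.ncard_image_of_injective D e.injective]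
    exact disjDomNumber_le_ncard (dominated_image e hD)

theorem exists_adj_dist_eq_add_one (hG : G.Connected) {r v : V} (hv : v ≠ r) :
    ∃ p, G.Adj v p ∧ G.dist r v = G.dist r p + 1 := by
  obtain ⟨w, hw⟩ := hG.exists_walk_length_eq_dist v r
  cases w with
  | nil => exact absurd rfl hv
  | @cons _ p _ h q =>
    have hpr : G.dist p r ≤ q.length := SimpleGraph.dist_le q
    have htri := hG.dist_triangle (u := v) (v := p) (w := r)
    have hvp : G.dist v p = 1 := SimpleGraph.dist_eq_one_iff_adj.2 h
    rw [SimpleGraph.Walk.length_cons] at hw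
    refine ⟨p, h, ?_⟩
    rw [SimpleGraph.dist_comm (u := r), SimpleGraph.dist_comm (u := r)]
    omega

theorem eq_of_adj_of_dist_eq_add_one (hG : G.IsTree) {r v a b : V} (ha : G.Adj v a)
    (hb : G.Adj v b) (hda : G.dist r v = G.dist r a + 1) (hdb : G.dist r v = G.dist r b + 1) :
    a = b := by
  classical
  have notMem_support {c : V} (s : G.Walk r c) (hs : s.length = G.dist r c)
      (hc : G.dist r v = G.dist r c + 1) : v ∉ s.support := fun hmem => by
    have := SimpleGraph.dist_le (s.takeUntil v hmem)
    have := s.length_takeUntil_le_length hmem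
    omega
  obtain ⟨p, hp, hpl⟩ := hG.connected.exists_path_of_dist r a
  obtain ⟨q, hq, hql⟩ := hG.connected.exists_path_of_dist r b
  have hp' := hp.concat (notMem_support p hpl hda) ha.symm
  have hq' := hq.concat (notMem_support q hql hdb) hb.symm
  have hpq := Subtype.mk.inj ((hG.isAcyclic.subsingleton_path _ _).elim ⟨_, hp'⟩ ⟨_, hq'⟩)
  simpa using congrArg SimpleGraph.Walk.penultimate hpq

theorem dist_eq_add_one_of_adj_of_ne (hG : G.IsTree) {r v p x : V} (hp : G.Adj v p)
    (hdp : G.dist r v = G.dist r p + 1) (hx : G.Adj v x) (hne : x ≠ p) :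
    G.dist r x = G.dist r v + 1 :=
  (hG.dist_eq_dist_add_one_of_adj r hx).resolve_left fun h =>
    hne (eq_of_adj_of_dist_eq_add_one hG hx hp h hdp)

/-! ### End sets -/

/-- `E` is the set of ends of a decomposition of `G` into pieces: edges `e c` with end `e` and leaf
`c`, and paths `e c d e'` with ends `e`, `e'` and *inner* vertices `c`, `d` of degree two. Every
vertex `v` has a *mate*, the inner vertex next to it if `v` is an end, and the end next to it if
`v` is inner; every end is adjacent to an end of another piece. -/
structure IsEndSet (G : SimpleGraph V) (E : Set V) : Prop where
  existsUnique_mate : ∀ v, ∃! w, G.Adj v w ∧ (w ∈ E ↔ v ∉ E)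
  inner_unique : ∀ c ∉ E, ∀ d ∉ E, ∀ d' ∉ E, G.Adj c d → G.Adj c d' → d = d'
  exists_adj_end : ∀ e ∈ E, ∃ x ∈ E, G.Adj e x

/-- The end `e` has at most one neighbour outside its piece. -/
def SmallEnd (G : SimpleGraph V) (E : Set V) (e : V) : Prop :=
  {x ∈ E | G.Adj e x}.Subsingleton

/-- Every piece of the decomposition with set of ends `E` has a small end: given an inner vertex
`c`, the end is next to `c` or to the other inner vertex `d` of the piece. -/
structure IsTight (G : SimpleGraph V) (E : Set V) : Prop extends IsEndSet G E where
  exists_small : ∀ c ∉ E, ∃ d ∉ E, (d = c ∨ G.Adj c d) ∧ ∃ e ∈ E, G.Adj d e ∧ SmallEnd G E e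

theorem SmallEnd.preimage (f : G ↪g H) {E : Set W} {v : V} (h : SmallEnd H E (f v)) :
    SmallEnd G (f ⁻¹' E) v :=
  fun _ ⟨hx, hvx⟩ _ ⟨hy, hvy⟩ =>
    f.injective (h ⟨hx, f.map_adj_iff.2 hvx⟩ ⟨hy, f.map_adj_iff.2 hvy⟩)

theorem IsEndSet.preimage (e : G ≃g H) {E : Set W} (h : IsEndSet H E) :
    IsEndSet G (e ⁻¹' E) := by
  obtain ⟨hmate, hinner, hend⟩ := h
  simp only [e.surjective.forall, e.surjective.exists, e.bijective.existsUnique_iff,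
    e.map_adj_iff, e.injective.eq_iff] at hmate hinner hend
  exact ⟨hmate, hinner, hend⟩

theorem IsTight.preimage (e : G ≃g H) {E : Set W} (h : IsTight H E) : IsTight G (e ⁻¹' E) := by
  refine ⟨h.toIsEndSet.preimage e, fun c hc => ?_⟩
  obtain ⟨d, hd, hcd, x, hx, hdx, hs⟩ := h.exists_small (e c) hc
  obtain ⟨d, rfl⟩ := e.surjective d
  obtain ⟨x, rfl⟩ := e.surjective x
  exact ⟨d, hd, hcd.imp (e.injective ·) e.map_adj_iff.1, x, hx, e.map_adj_iff.1 hdx,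
    hs.preimage e.toEmbedding⟩

theorem two_mul_ncard_image_sym2 {α : Type*} {s : Set α} (hs : s.Finite) {σ : α → α}
    (hmaps : Set.MapsTo σ s s) (hinv : Set.LeftInvOn σ σ s) :
    2 * ((fun a => s(a, σ a)) '' s).ncard = s.ncard + {a ∈ s | σ a = a}.ncard := by
  classical
  lift s to Finset α using hs
  have fiber : ∀ z ∈ s.image fun a => s(a, σ a),
      ∑ b ∈ s with s(b, σ b) = z, (1 + if σ b = b then 1 else 0) = 2 := by
    refine Finset.forall_mem_image.2 fun a ha => ?_
    have hfib : s.filter (fun b => s(b, σ b) = s(a, σ a)) = {a, σ a} := by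
      ext b
      simp only [Finset.mem_filter, Sym2.eq_iff, Finset.mem_insert, Finset.mem_singleton]
      constructor
      · rintro ⟨-, ⟨rfl, -⟩ | ⟨rfl, -⟩⟩ <;> simp
      · rintro (rfl | rfl)
        · exact ⟨ha, Or.inl ⟨rfl, rfl⟩⟩
        · exact ⟨hmaps ha, Or.inr ⟨rfl, hinv ha⟩⟩
    by_cases hfix : σ a = a
    · rw [hfib, hfix, Finset.pair_eq_singleton, Finset.sum_singleton, if_pos hfix]
    · rw [hfib, Finset.sum_pair (Ne.symm hfix), hinv ha, if_neg hfix, if_neg (Ne.symm hfix)]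
  have himage : (fun a => s(a, σ a)) '' (s : Set α) = (s.image fun a => s(a, σ a) : Finset _) :=
    Finset.coe_image.symm
  have hfixed : {a ∈ (s : Set α) | σ a = a} = (s.filter fun a => σ a = a : Finset _) := by
    ext; simp
  rw [himage, hfixed, Set.ncard_coe_finset, Set.ncard_coe_finset, Set.ncard_coe_finset,
    Finset.card_filter, Finset.card_eq_sum_ones s, ← Finset.sum_add_distrib,
    ← Finset.sum_fiberwise_of_maps_to fun a ha => Finset.mem_image_of_mem (fun a => s(a, σ a)) ha,
    Finset.sum_congr rfl fiber, Finset.sum_const, smul_eq_mul, mul_comm]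

namespace IsEndSet

variable {E : Set V}

/-- The end next to an inner vertex, or the inner vertex next to an end. -/
noncomputable def mate (h : IsEndSet G E) (v : V) : V :=
  (h.existsUnique_mate v).choose

theorem adj_mate (h : IsEndSet G E) (v : V) : G.Adj v (h.mate v) :=
  (h.existsUnique_mate v).choose_spec.1.1

theorem mate_mem_iff (h : IsEndSet G E) {v : V} : h.mate v ∈ E ↔ v ∉ E :=
  (h.existsUnique_mate v).choose_spec.1.2

theorem mate_notMem (h : IsEndSet G E) {v : V} (hv : v ∈ E) : h.mate v ∉ E := by
  simpa [h.mate_mem_iff] using hv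

theorem eq_mate (h : IsEndSet G E) {v w : V} (hvw : G.Adj v w) (hE : w ∈ E ↔ v ∉ E) :
    w = h.mate v :=
  (h.existsUnique_mate v).choose_spec.2 w ⟨hvw, hE⟩

theorem mate_mate (h : IsEndSet G E) (v : V) : h.mate (h.mate v) = v :=
  (h.eq_mate (h.adj_mate v).symm (by rw [h.mate_mem_iff, not_not])).symm

theorem mate_injective (h : IsEndSet G E) : Function.Injective h.mate :=
  Function.LeftInverse.injective h.mate_mate

theorem ncard_compl (h : IsEndSet G E) : (Eᶜ).ncard = E.ncard := by
  have : h.mate '' E = Eᶜ := Set.ext fun v =>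
    ⟨by rintro ⟨e, he, rfl⟩; exact h.mate_notMem he,
      fun hv => ⟨h.mate v, h.mate_mem_iff.2 hv, h.mate_mate v⟩⟩
  rw [← this, Set.ncard_image_of_injective E h.mate_injective]

theorem numSupports_eq (h : IsEndSet G E) : numSupports G = numLeaves G := by
  have : {v | IsSupport G v} = h.mate '' {v | IsLeaf G v} := by
    ext v
    constructor
    · rintro ⟨w, hvw, hw⟩
      exact ⟨w, hw, (isLeaf_iff.1 hw).unique (h.adj_mate w) hvw.symm⟩
    · rintro ⟨w, hw, rfl⟩
      exact ⟨w, (h.adj_mate w).symm, hw⟩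
  rw [numSupports, this, Set.ncard_image_of_injective _ h.mate_injective, numLeaves]

theorem isLeaf_iff (h : IsEndSet G E) {c : V} : IsLeaf G c ↔ c ∉ E ∧ ∀ d ∉ E, ¬ G.Adj c d := by
  rw [DisjDom.isLeaf_iff]
  constructor
  · intro hleaf
    have hc : c ∉ E := fun hc => by
      obtain ⟨x, hx, hcx⟩ := h.exists_adj_end c hc
      exact h.mate_notMem hc (hleaf.unique hcx (h.adj_mate c) ▸ hx)
    exact ⟨hc, fun d hd hcd => hd (hleaf.unique (h.adj_mate c) hcd ▸ h.mate_mem_iff.2 hc)⟩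
  · rintro ⟨hc, hinner⟩
    refine ⟨h.mate c, h.adj_mate c, fun x hx => h.eq_mate hx (iff_of_true ?_ hc)⟩
    by_contra hxE
    exact hinner x hxE hx

open Classical in
/-- The other inner vertex of the piece of an inner vertex `c`; when there is none, that is, when
`c` is a leaf, `c` itself. -/
noncomputable def link (_ : IsEndSet G E) (c : V) : V :=
  if h : ∃ d ∉ E, G.Adj c d then h.choose else c

theorem link_eq_of_adj (h : IsEndSet G E) {c d : V} (hc : c ∉ E) (hd : d ∉ E) (hcd : G.Adj c d) :
    h.link c = d := by
  have hex : ∃ d ∉ E, G.Adj c d := ⟨d, hd, hcd⟩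
  rw [link, dif_pos hex]
  exact h.inner_unique c hc _ hex.choose_spec.1 d hd hex.choose_spec.2 hcd

theorem link_eq_self (h : IsEndSet G E) {c : V} (hc : ∀ d ∉ E, ¬ G.Adj c d) : h.link c = c :=
  dif_neg (by simpa using hc)

theorem link_eq_self_iff (h : IsEndSet G E) {c : V} (hc : c ∉ E) :
    h.link c = c ↔ IsLeaf G c := by
  rw [h.isLeaf_iff]
  refine ⟨fun hlink => ⟨hc, fun d hd hcd => hcd.ne ?_⟩, fun hleaf => h.link_eq_self hleaf.2⟩
  rw [← hlink, h.link_eq_of_adj hc hd hcd]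

theorem link_notMem (h : IsEndSet G E) {c : V} (hc : c ∉ E) : h.link c ∉ E := by
  by_cases hex : ∃ d ∉ E, G.Adj c d
  · obtain ⟨d, hd, hcd⟩ := hex
    rwa [h.link_eq_of_adj hc hd hcd]
  · push Not at hex
    rwa [h.link_eq_self hex]

theorem link_link (h : IsEndSet G E) {c : V} (hc : c ∉ E) : h.link (h.link c) = c := by
  by_cases hex : ∃ d ∉ E, G.Adj c d
  · obtain ⟨d, hd, hcd⟩ := hex
    rw [h.link_eq_of_adj hc hd hcd, h.link_eq_of_adj hd hc hcd.symm]
  · push Not at hex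
    rw [h.link_eq_self hex, h.link_eq_self hex]

open Classical in
/-- The inner vertex among `v` and its mate. -/
noncomputable def core (h : IsEndSet G E) (v : V) : V :=
  if v ∈ E then h.mate v else v

theorem core_of_mem (h : IsEndSet G E) {v : V} (hv : v ∈ E) : h.core v = h.mate v :=
  if_pos hv

theorem core_of_notMem (h : IsEndSet G E) {v : V} (hv : v ∉ E) : h.core v = v :=
  if_neg hv

theorem core_notMem (h : IsEndSet G E) (v : V) : h.core v ∉ E := by
  by_cases hv : v ∈ E
  · rw [h.core_of_mem hv]; exact h.mate_notMem hv
  · rwa [h.core_of_notMem hv]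

/-- The piece containing `v`, represented by the pair of its inner vertices. -/
noncomputable def piece (h : IsEndSet G E) (v : V) : Sym2 V :=
  s(h.core v, h.link (h.core v))

/-- The number of pieces of the decomposition. -/
noncomputable def numPieces (h : IsEndSet G E) : ℕ :=
  (Set.range h.piece).ncard

theorem piece_mate (h : IsEndSet G E) (v : V) : h.piece (h.mate v) = h.piece v := by
  have : h.core (h.mate v) = h.core v := by
    by_cases hv : v ∈ E
    · rw [h.core_of_mem hv, h.core_of_notMem (h.mate_notMem hv)]
    · rw [h.core_of_notMem hv, h.core_of_mem (h.mate_mem_iff.2 hv), h.mate_mate]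
  rw [piece, piece, this]

theorem piece_eq_of_adj (h : IsEndSet G E) {c x : V} (hc : c ∉ E) (hcx : G.Adj c x) :
    h.piece x = h.piece c := by
  by_cases hx : x ∈ E
  · rw [h.eq_mate hcx (iff_of_true hx hc), h.piece_mate]
  · rw [piece, piece, h.core_of_notMem hc, h.core_of_notMem hx, h.link_eq_of_adj hc hx hcx,
      h.link_eq_of_adj hx hc hcx.symm, Sym2.eq_swap]

theorem eq_or_adj_of_piece_eq (h : IsEndSet G E) {v w : V} (hvw : h.piece v = h.piece w) :
    h.core v = h.core w ∨ G.Adj (h.core v) (h.core w) := by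
  by_cases hex : ∃ d ∉ E, G.Adj (h.core w) d
  · obtain ⟨d, hd, hwd⟩ := hex
    rw [piece, piece, h.link_eq_of_adj (h.core_notMem w) hd hwd, Sym2.eq_iff] at hvw
    rcases hvw with ⟨heq, -⟩ | ⟨heq, -⟩
    · exact Or.inl heq
    · exact Or.inr (heq ▸ hwd.symm)
  · push Not at hex
    rw [piece, piece, h.link_eq_self hex, Sym2.eq_iff] at hvw
    exact Or.inl (hvw.elim And.left And.left)

theorem weight_eq (h : IsEndSet G E) [Finite V] : weight G = 4 * h.numPieces := by
  have hrange : Set.range h.piece = (fun c => s(c, h.link c)) '' Eᶜ := by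
    refine Set.Subset.antisymm ?_ ?_
    · rintro _ ⟨v, rfl⟩
      exact ⟨h.core v, h.core_notMem v, rfl⟩
    · rintro _ ⟨c, hc, rfl⟩
      exact ⟨c, by rw [piece, h.core_of_notMem hc]⟩
  have hleaf : {c ∈ Eᶜ | h.link c = c} = {c | IsLeaf G c} := Set.ext fun c =>
    ⟨fun hc => (h.link_eq_self_iff hc.1).1 hc.2, fun hc =>
      have hcE := (h.isLeaf_iff.1 hc).1
      ⟨hcE, (h.link_eq_self_iff hcE).2 hc⟩⟩
  have hcount := two_mul_ncard_image_sym2 Eᶜ.toFinite (fun c => h.link_notMem (c := c))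
    (fun c => h.link_link (c := c))
  have hcard := Set.ncard_add_ncard_compl E
  have hcompl := h.ncard_compl
  rw [← hrange, hleaf] at hcount
  rw [weight, h.numSupports_eq]
  unfold numPieces numLeaves
  omega

/-- The ends which, in the tree rooted at `r`, lie above their mates. -/
def upperEnds (h : IsEndSet G E) (r : V) : Set V :=
  {e ∈ E | G.dist r (h.mate e) = G.dist r e + 1}

theorem dist_eq_of_notMem_upperEnds (h : IsEndSet G E) (hG : G.IsTree) {r e : V} (he : e ∈ E)
    (heD : e ∉ h.upperEnds r) : G.dist r e = G.dist r (h.mate e) + 1 :=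
  (hG.dist_eq_dist_add_one_of_adj r (h.adj_mate e)).resolve_right fun hd => heD ⟨he, hd⟩

theorem mem_upperEnds_of_adj (h : IsEndSet G E) (hG : G.IsTree) {r e x : V} (he : e ∈ E)
    (heD : e ∉ h.upperEnds r) (hx : x ∈ E) (hex : G.Adj e x) :
    x ∈ h.upperEnds r ∧ G.dist r x = G.dist r e + 1 := by
  have ne_mate {a b : V} (ha : a ∈ E) (hb : b ∈ E) : b ≠ h.mate a :=
    fun hab => h.mate_notMem ha (hab ▸ hb)
  have hdx := dist_eq_add_one_of_adj_of_ne hG (h.adj_mate e)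
    (h.dist_eq_of_notMem_upperEnds hG he heD) hex (ne_mate he hx)
  exact ⟨⟨hx, dist_eq_add_one_of_adj_of_ne hG hex.symm hdx (h.adj_mate x)
    (ne_mate hx he).symm⟩, hdx⟩

theorem injOn_piece_upperEnds (h : IsEndSet G E) (hG : G.IsTree) (r : V) :
    Set.InjOn h.piece (h.upperEnds r) := by
  -- If adjacent inner vertices both had their parents in `E`, one would be the parent of the other.
  have not_lower {a b : V} (ha : a ∈ h.upperEnds r) (hb : b ∈ h.upperEnds r)
      (hab : G.Adj (h.mate a) (h.mate b)) :
      G.dist r (h.mate a) ≠ G.dist r (h.mate b) + 1 := fun hd => by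
    have ha' : G.Adj (h.mate a) a := (h.adj_mate a).symm
    exact h.mate_notMem hb.1 (eq_of_adj_of_dist_eq_add_one hG ha' hab ha.2 hd ▸ ha.1)
  intro a ha b hb hab
  have hcore := h.eq_or_adj_of_piece_eq hab
  rw [h.core_of_mem ha.1, h.core_of_mem hb.1] at hcore
  rcases hcore with heq | hadj
  · exact h.mate_injective heq
  · rcases hG.dist_eq_dist_add_one_of_adj r hadj with hd | hd
    · exact absurd hd (not_lower ha hb hadj)
    · exact absurd hd (not_lower hb ha hadj.symm)

theorem piece_ne_of_mem_upperEnds (h : IsEndSet G E) (hG : G.Connected) {r e : V}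
    (hr : r ∉ E) (he : e ∈ h.upperEnds r) : h.piece e ≠ h.piece r := by
  intro hpiece
  have hcore := h.eq_or_adj_of_piece_eq hpiece
  rw [h.core_of_mem he.1, h.core_of_notMem hr] at hcore
  have hde := he.2
  rcases hcore with heq | hadj
  · rw [heq, SimpleGraph.dist_self] at hde
    omega
  · rw [SimpleGraph.dist_eq_one_iff_adj.2 hadj.symm] at hde
    have hre : r = e := hG.dist_eq_zero_iff.1 (by omega)
    exact hr (hre ▸ he.1)

theorem ncard_upperEnds_lt (h : IsEndSet G E) [Finite V] (hG : G.IsTree) {r : V} (hr : r ∉ E) :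
    (h.upperEnds r).ncard < h.numPieces := by
  have hnew : h.piece r ∉ h.piece '' h.upperEnds r := by
    rintro ⟨e, he, hpiece⟩
    exact h.piece_ne_of_mem_upperEnds hG.connected hr he hpiece
  have hsub : insert (h.piece r) (h.piece '' h.upperEnds r) ⊆ Set.range h.piece :=
    Set.insert_subset ⟨r, rfl⟩ (Set.image_subset_range _ _)
  have hcard := Set.ncard_le_ncard hsub
  rwa [Set.ncard_insert_of_notMem hnew, (h.injOn_piece_upperEnds hG r).ncard_image] at hcard

/-- If the mate of `v` is not an upper end, there are two upper ends at distance two from `v`: the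
mate of the vertex above `v` in its piece, and an end adjacent to the mate of `v`. -/
theorem dominated_upperEnds_of_notMem (h : IsEndSet G E) (hG : G.IsTree) {r v : V} (hv : v ∉ E)
    (hvr : v ≠ r) (hadj : ¬ G.Adj v r) : Dominated G (h.upperEnds r) v := by
  by_cases hmate : h.mate v ∈ h.upperEnds r
  · exact Or.inr (Or.inl ⟨h.mate v, hmate, h.adj_mate v⟩)
  have hmE : h.mate v ∈ E := h.mate_mem_iff.2 hv
  have hlower := h.dist_eq_of_notMem_upperEnds hG hmE hmate
  rw [h.mate_mate] at hlower
  obtain ⟨x, hx, hmx⟩ := h.exists_adj_end (h.mate v) hmE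
  obtain ⟨hxD, hxd⟩ := h.mem_upperEnds_of_adj hG hmE hmate hx hmx
  obtain ⟨d, hvd, hd⟩ := exists_adj_dist_eq_add_one hG.connected hvr
  have hdE : d ∉ E := fun hdE => by
    rw [h.eq_mate hvd (iff_of_true hdE hv)] at hd
    omega
  obtain ⟨p, hdp, hp⟩ := exists_adj_dist_eq_add_one hG.connected
    (fun hdr => hadj (hdr ▸ hvd) : d ≠ r)
  have hpE : p ∈ E := by
    by_contra hpE
    rw [h.inner_unique d hdE v hv p hpE hvd.symm hdp] at hd
    omega
  have hpD : p ∈ h.upperEnds r :=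
    ⟨hpE, by rwa [h.eq_mate hdp (iff_of_true hpE hdE), h.mate_mate,
      ← h.eq_mate hdp (iff_of_true hpE hdE)]⟩
  refine Or.inr (Or.inr ⟨p, hpD, x, hxD, ?_, ⟨d, hvd, hdp⟩, h.mate v, h.adj_mate v, hmx⟩)
  rintro rfl
  omega

theorem dominated_upperEnds_of_mem (h : IsEndSet G E) (hG : G.IsTree) {r v : V} (hv : v ∈ E) :
    Dominated G (h.upperEnds r) v := by
  by_cases hvD : v ∈ h.upperEnds r
  · exact Or.inl hvD
  · obtain ⟨x, hx, hvx⟩ := h.exists_adj_end v hv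
    exact Or.inr (Or.inl ⟨x, (h.mem_upperEnds_of_adj hG hv hvD hx hvx).1, hvx⟩)

theorem dominated_upperEnds_of_not_smallEnd (h : IsEndSet G E) (hG : G.IsTree) {r v : V}
    (hv : v ∉ E) (hmate : h.mate v ∉ h.upperEnds r) (hlarge : ¬ SmallEnd G E (h.mate v)) :
    Dominated G (h.upperEnds r) v := by
  obtain ⟨x, ⟨hx, hmx⟩, y, ⟨hy, hmy⟩, hxy⟩ := Set.not_subsingleton_iff.1 hlarge
  have mem_upper {z : V} (hz : z ∈ E) (hmz : G.Adj (h.mate v) z) : z ∈ h.upperEnds r :=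
    (h.mem_upperEnds_of_adj hG (h.mate_mem_iff.2 hv) hmate hz hmz).1
  exact Or.inr (Or.inr ⟨x, mem_upper hx hmx, y, mem_upper hy hmy, hxy,
    ⟨h.mate v, h.adj_mate v, hmx⟩, h.mate v, h.adj_mate v, hmy⟩)

/-- Were all ends of the piece of an inner vertex `r` large, then the upper ends of the other
pieces, in the tree rooted at `r`, would dominate. -/
theorem isTight_of_weight_le (h : IsEndSet G E) [Finite V] (hG : G.IsTree)
    (hweight : weight G ≤ 4 * disjDomNumber G) : IsTight G E := by
  refine ⟨h, fun r hr => ?_⟩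
  by_contra! hlarge
  have hdom (v : V) : Dominated G (h.upperEnds r) v := by
    by_cases hv : v ∈ E
    · exact h.dominated_upperEnds_of_mem hG hv
    by_cases hvr : v = r ∨ G.Adj r v
    · have hpiece : h.piece v = h.piece r := by
        rcases hvr with rfl | hrv
        · rfl
        · exact h.piece_eq_of_adj hr hrv
      refine h.dominated_upperEnds_of_not_smallEnd hG hv (fun hmate => ?_)
        (hlarge v hv hvr _ (h.mate_mem_iff.2 hv) (h.adj_mate v))
      exact h.piece_ne_of_mem_upperEnds hG.connected hr hmate ((h.piece_mate v).trans hpiece)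
    · push Not at hvr
      exact h.dominated_upperEnds_of_notMem hG hv hvr.1 fun hadj => hvr.2 hadj.symm
  have hle := disjDomNumber_le_ncard hdom
  have hlt := h.ncard_upperEnds_lt hG hr
  rw [h.weight_eq] at hweight
  omega

theorem exists_mem_piece_eq_of_smallEnd (h : IsEndSet G E) {D : Set V} {c : V} (hc : c ∉ E)
    (hsmall : SmallEnd G E (h.mate c)) (hD : Dominated G D c) :
    ∃ v ∈ D, h.piece v = h.piece c := by
  by_contra! hmiss
  have end_adj_mate {a x : V} (ha : a ∈ D) (hcx : G.Adj c x) (hxa : G.Adj x a) :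
      a ∈ {z ∈ E | G.Adj (h.mate c) z} := by
    have hxE : x ∈ E := by
      by_contra hxE
      exact hmiss a ha ((h.piece_eq_of_adj hxE hxa).trans (h.piece_eq_of_adj hc hcx))
    have hx := h.eq_mate hcx (iff_of_true hxE hc)
    subst hx
    refine ⟨?_, hxa⟩
    by_contra haE
    exact hmiss a ha ((h.piece_eq_of_adj haE hxa.symm).symm.trans (h.piece_mate c))
  rcases hD with hcD | ⟨w, hw, hcw⟩ | ⟨a, ha, b, hb, hab, ⟨x, hcx, hxa⟩, y, hcy, hyb⟩
  · exact hmiss c hcD rfl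
  · exact hmiss w hw (h.piece_eq_of_adj hc hcw)
  · exact hab (hsmall (end_adj_mate ha hcx hxa) (end_adj_mate hb hcy hyb))

end IsEndSet

/-- Every dominating set meets every piece, since the inner vertex next to a small end can only be
dominated from within its piece. -/
theorem IsTight.weight_le [Finite V] {E : Set V} (h : IsTight G E) :
    weight G ≤ 4 * disjDomNumber G := by
  have hE := h.toIsEndSet
  obtain ⟨D, hD, hcard⟩ := exists_dominating_ncard_eq G
  have hmeet : Set.range hE.piece ⊆ hE.piece '' D := by
    rintro _ ⟨v, rfl⟩
    obtain ⟨c, hc, hcv⟩ : ∃ c ∉ E, hE.piece c = hE.piece v := by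
      by_cases hv : v ∈ E
      · exact ⟨hE.mate v, hE.mate_notMem hv, hE.piece_mate v⟩
      · exact ⟨v, hv, rfl⟩
    obtain ⟨d, hd, hdc, e, he, hde, hsmall⟩ := h.exists_small c hc
    rw [hE.eq_mate hde (iff_of_true he hd)] at hsmall
    obtain ⟨w, hw, hwd⟩ := hE.exists_mem_piece_eq_of_smallEnd hd hsmall (hD d)
    have hdc' : hE.piece d = hE.piece c := by
      rcases hdc with rfl | hcd
      · rfl
      · exact hE.piece_eq_of_adj hc hcd
    exact ⟨w, hw, hwd.trans (hdc'.trans hcv)⟩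
  have hle : hE.numPieces ≤ D.ncard := (Set.ncard_le_ncard hmeet).trans (Set.ncard_image_le)
  rw [hE.weight_eq, ← hcard]
  omega

end

/-! ### Attached paths -/

/-- `v` has at least two neighbours. -/
def Branching {V : Type*} (G : SimpleGraph V) (v : V) : Prop :=
  (G.neighborSet v).Nontrivial

section attach

variable {V W : Type*} {G : SimpleGraph V} {H : SimpleGraph W} {v : V} {k : ℕ}

theorem Branching.not_isLeaf (h : Branching G v) : ¬ IsLeaf G v := fun hleaf =>
  let ⟨_, hx, _, hy, hxy⟩ := h
  hxy ((isLeaf_iff.1 hleaf).unique hx hy)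

@[simp] theorem attachPath_inl_inl {a b : V} :
    (attachPath G v k).Adj (.inl a) (.inl b) ↔ G.Adj a b := Iff.rfl

@[simp] theorem attachPath_inl_inr {a : V} {i : Fin k} :
    (attachPath G v k).Adj (.inl a) (.inr i) ↔ a = v ∧ i.val = 0 := Iff.rfl

@[simp] theorem attachPath_inr_inl {a : V} {i : Fin k} :
    (attachPath G v k).Adj (.inr i) (.inl a) ↔ a = v ∧ i.val = 0 := Iff.rfl

@[simp] theorem attachPath_inr_inr {i j : Fin k} :
    (attachPath G v k).Adj (.inr i) (.inr j) ↔ i.val + 1 = j.val ∨ j.val + 1 = i.val :=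
  SimpleGraph.pathGraph_adj

/-- The inclusion of a graph in the graph with a path attached. -/
def attachInl (G : SimpleGraph V) (v : V) (k : ℕ) : G ↪g attachPath G v k where
  toFun := Sum.inl
  inj' := Sum.inl_injective
  map_rel_iff' := Iff.rfl

/-- Attaching a shorter path gives an induced subgraph. -/
def attachCast (G : SimpleGraph V) (v : V) {j k : ℕ} (h : j ≤ k) :
    attachPath G v j ↪g attachPath G v k where
  toFun := Sum.map id (Fin.castLE h)
  inj' := Function.injective_id.sumMap (Fin.castLE_injective h)
  map_rel_iff' := by rintro (a | i) (b | j) <;> simp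

/-- Attaching paths to isomorphic graphs. -/
def attachCongr (e : G ≃g H) (v : V) (k : ℕ) : attachPath G v k ≃g attachPath H (e v) k where
  toEquiv := Equiv.sumCongr e.toEquiv (Equiv.refl _)
  map_rel_iff' := by rintro (a | i) (b | j) <;> simp [e.map_adj_iff]

/-- Attaching a path in two portions. -/
def attachAppend (G : SimpleGraph V) (v : V) (j k : ℕ) :
    attachPath (attachPath G v (j + 1)) (.inr (Fin.last j)) k ≃g attachPath G v (j + 1 + k) where
  toEquiv := (Equiv.sumAssoc _ _ _).trans (Equiv.sumCongr (Equiv.refl _) finSumFinEquiv)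
  map_rel_iff' := by
    rintro ((a | i) | i) ((b | l) | l) <;>
      simp only [Equiv.trans_apply, Equiv.sumAssoc_apply_inl_inl, Equiv.sumAssoc_apply_inl_inr,
        Equiv.sumAssoc_apply_inr, Equiv.sumCongr_apply, Sum.map_inl, Sum.map_inr,
        Equiv.coe_refl, id_eq, finSumFinEquiv_apply_left, finSumFinEquiv_apply_right,
        attachPath_inl_inl, attachPath_inl_inr, attachPath_inr_inl, attachPath_inr_inr,
        Fin.val_castAdd, Fin.val_natAdd, Sum.inr.injEq, Fin.ext_iff, Fin.val_last,
        reduceCtorEq, false_and] <;> grind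

/-- A path attached to a single vertex is a path. -/
def attachIsoPathGraph [Unique V] (G : SimpleGraph V) (v : V) (k : ℕ) :
    attachPath G v k ≃g SimpleGraph.pathGraph (1 + k) where
  toEquiv := (Equiv.sumCongr (Equiv.ofUnique V (Fin 1)) (Equiv.refl _)).trans finSumFinEquiv
  map_rel_iff' := by
    rintro (a | i) (b | j) <;>
      (simp [SimpleGraph.pathGraph_adj, Subsingleton.elim _ v]; try omega)

theorem connected_attachPath (hG : G.Connected) (v : V) (k : ℕ) :
    (attachPath G v k).Connected := by
  have reachable_inr (i : ℕ) (hi : i < k) :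
      (attachPath G v k).Reachable (.inr ⟨i, hi⟩) (.inl v) := by
    induction i with
    | zero => exact SimpleGraph.Adj.reachable (by simp)
    | succ i ih => exact (SimpleGraph.Adj.reachable (by simp)).trans (ih (by omega))
  have reachable (x : V ⊕ Fin k) : (attachPath G v k).Reachable x (.inl v) := by
    rcases x with a | i
    · exact (hG.preconnected a v).map (attachInl G v k).toHom
    · exact reachable_inr i i.2
  exact { preconnected := fun x y => (reachable x).trans (reachable y).symm
          nonempty := ⟨.inl v⟩ }

/-- The map contracting an attached path to the vertex `v` at which it is attached. -/
def contract (v : V) : V ⊕ Fin k → V :=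
  Sum.elim id fun _ => v

theorem adj_contract {x y : V ⊕ Fin k} (hxy : (attachPath G v k).Adj x y) :
    contract v x = contract v y ∨ G.Adj (contract v x) (contract v y) := by
  rcases x with a | i <;> rcases y with b | j <;> simp_all [contract]

theorem connected_of_attachPath (h : (attachPath G v k).Connected) : G.Connected := by
  have reachable {x y : V ⊕ Fin k} (p : (attachPath G v k).Walk x y) :
      G.Reachable (contract v x) (contract v y) := by
    induction p with
    | nil => exact SimpleGraph.Reachable.refl _
    | cons hxy _ ih =>
      rcases adj_contract hxy with heq | hadj
      · exact heq ▸ ih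
      · exact hadj.reachable.trans ih
  exact { preconnected := fun a b => (h.preconnected (.inl a) (.inl b)).elim reachable
          nonempty := ⟨v⟩ }

theorem isTree_of_attachPath (h : (attachPath G v k).IsTree) : G.IsTree :=
  ⟨connected_of_attachPath h.connected, h.isAcyclic.embedding (attachInl G v k)⟩

theorem isTree_attachPath_of_le (h : (attachPath G v k).IsTree) {j : ℕ} (hj : j ≤ k) :
    (attachPath G v j).IsTree :=
  ⟨connected_attachPath (connected_of_attachPath h.connected) v j,
    h.isAcyclic.embedding (attachCast G v hj)⟩

theorem branching_inl (hv : ∃ w, G.Adj v w) (hk : 0 < k) :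
    Branching (attachPath G v k) (.inl v) := by
  obtain ⟨w, hw⟩ := hv
  exact ⟨.inl w, hw, .inr ⟨0, hk⟩, by simp, by simp⟩

theorem isLeaf_inl_iff {a : V} (ha : a ≠ v) :
    IsLeaf (attachPath G v k) (.inl a) ↔ IsLeaf G a := by
  simp [isLeaf_iff, ExistsUnique, ha]

theorem isLeaf_inr_iff (i : Fin k) : IsLeaf (attachPath G v k) (.inr i) ↔ i.val + 1 = k := by
  obtain ⟨p, hp_ne, hp⟩ : ∃ p, (∀ h : i.val + 1 < k, .inr ⟨i + 1, h⟩ ≠ p) ∧ ∀ x,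
      (attachPath G v k).Adj (.inr i) x ↔ x = p ∨ ∃ h : i.val + 1 < k, x = .inr ⟨i + 1, h⟩ := by
    obtain ⟨_ | i, hi⟩ := i
    · exact ⟨.inl v, by simp, by rintro (a | j) <;> (simp [Fin.ext_iff]; try omega)⟩
    · exact ⟨.inr ⟨i, by omega⟩, by simp; omega, by rintro (a | j) <;> simp [Fin.ext_iff]; omega⟩
  rw [isLeaf_iff]
  constructor
  · intro hleaf
    by_contra hne
    have hi : i.val + 1 < k := by omega
    exact hp_ne hi (hleaf.unique ((hp _).2 (.inr ⟨hi, rfl⟩)) ((hp _).2 (.inl rfl)))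
  · exact fun hi => ⟨p, (hp p).2 (.inl rfl), fun x hx =>
      ((hp x).1 hx).resolve_right fun ⟨hlt, _⟩ => hlt.ne hi⟩

theorem numLeaves_attachPath [Finite V] (hv : ∃ w, G.Adj v w) (hk : 0 < k) :
    numLeaves (attachPath G v k) = ({a | IsLeaf G a} \ {v}).ncard + 1 := by
  have leaves_eq : {x | IsLeaf (attachPath G v k) x} =
      insert (.inr ⟨k - 1, by omega⟩) (Sum.inl '' ({a | IsLeaf G a} \ {v})) := by
    ext (a | i)
    · rcases eq_or_ne a v with rfl | ha
      · simp [(branching_inl hv hk).not_isLeaf]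
      · simp [isLeaf_inl_iff ha, ha]
    · simp [isLeaf_inr_iff, Fin.ext_iff]
      omega
  rw [numLeaves, leaves_eq, Set.ncard_insert_of_notMem (by simp),
    Set.ncard_image_of_injective _ Sum.inl_injective]

/-- The vertices adjacent to a leaf different from `v`: those old vertices that are support
vertices because of an old leaf after a path is attached at `v`. -/
def supportsAvoiding (G : SimpleGraph V) (v : V) : Set V :=
  {a | ∃ w, G.Adj a w ∧ IsLeaf G w ∧ w ≠ v}

theorem isSupport_attachPath_iff (hv : ∃ w, G.Adj v w) (hk : 0 < k) (x : V ⊕ Fin k) :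
    IsSupport (attachPath G v k) x ↔ x ∈ Sum.inl '' supportsAvoiding G v ∨
      (attachPath G v k).Adj x (.inr ⟨k - 1, by omega⟩) := by
  constructor
  · rintro ⟨w | i, hxw, hw⟩
    · have hwv : w ≠ v := by
        rintro rfl
        exact (branching_inl hv hk).not_isLeaf hw
      rcases x with a | j
      · exact .inl ⟨a, ⟨w, hxw, (isLeaf_inl_iff hwv).1 hw, hwv⟩, rfl⟩
      · exact absurd hxw.1 hwv
    · have hi_last := (isLeaf_inr_iff i).1 hw
      have hi : i = ⟨k - 1, by omega⟩ := Fin.ext (by simp only; omega)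
      exact .inr (hi ▸ hxw)
  · rintro (⟨a, ⟨w, haw, hw, hwv⟩, rfl⟩ | hx)
    · exact ⟨.inl w, haw, (isLeaf_inl_iff hwv).2 hw⟩
    · exact ⟨_, hx, (isLeaf_inr_iff _).2 (by simp only; omega)⟩

theorem numSupports_attachPath [Finite V] (hv : ∃ w, G.Adj v w) (hk : 2 ≤ k) :
    numSupports (attachPath G v k) = (supportsAvoiding G v).ncard + 1 := by
  have supports_eq : {x | IsSupport (attachPath G v k) x} =
      insert (.inr ⟨k - 2, by omega⟩) (Sum.inl '' supportsAvoiding G v) := by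
    ext x
    rw [Set.mem_ofPred, isSupport_attachPath_iff hv (by omega), or_comm, Set.mem_insert_iff]
    rcases x with a | i <;> simp [Fin.ext_iff] <;> omega
  rw [numSupports, supports_eq, Set.ncard_insert_of_notMem (by simp),
    Set.ncard_image_of_injective _ Sum.inl_injective]

theorem numSupports_attachPath_one (hv : ∃ w, G.Adj v w) :
    numSupports (attachPath G v 1) = (insert v (supportsAvoiding G v)).ncard := by
  have supports_eq : {x | IsSupport (attachPath G v 1) x} =
      Sum.inl '' insert v (supportsAvoiding G v) := by
    ext x
    rw [Set.mem_ofPred, isSupport_attachPath_iff hv one_pos, or_comm]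
    rcases x with a | i <;> simp
  rw [numSupports, supports_eq, Set.ncard_image_of_injective _ Sum.inl_injective]

theorem weight_attachPath [Finite V] (hv : ∃ w, G.Adj v w) (hk : 2 ≤ k) :
    weight (attachPath G v k) =
      Nat.card V + ({a | IsLeaf G a} \ {v}).ncard + (supportsAvoiding G v).ncard + k + 2 := by
  rw [weight, numLeaves_attachPath hv (by omega), numSupports_attachPath hv hk, Nat.card_sum,
    Nat.card_fin]
  omega

theorem weight_attachPath_one [Finite V] (hv : ∃ w, G.Adj v w) :
    weight (attachPath G v 1) = Nat.card V + ({a | IsLeaf G a} \ {v}).ncard +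
      (insert v (supportsAvoiding G v)).ncard + 2 := by
  rw [weight, numLeaves_attachPath hv one_pos, numSupports_attachPath_one hv, Nat.card_sum,
    Nat.card_fin]
  omega

theorem weight_attachPath_one_add_le [Finite V] (hv : ∃ w, G.Adj v w) (hk : 2 ≤ k) :
    weight (attachPath G v 1) + k ≤ weight (attachPath G v k) + 1 := by
  have h := Set.ncard_insert_le v (supportsAvoiding G v)
  rw [weight_attachPath hv hk, weight_attachPath_one hv]
  omega

theorem Branching.exists_adj (hv : Branching G v) : ∃ w, G.Adj v w :=
  hv.nonempty

theorem Branching.weight_eq (hv : Branching G v) :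
    weight G = Nat.card V + ({a | IsLeaf G a} \ {v}).ncard + (supportsAvoiding G v).ncard := by
  have supports_eq : supportsAvoiding G v = {a | IsSupport G a} :=
    Set.ext fun a => exists_congr fun w => and_congr_right fun _ =>
      and_iff_left_of_imp fun hw hwv => hv.not_isLeaf (hwv ▸ hw)
  rw [supports_eq, Set.sdiff_singleton_eq_self (a := v) (s := {a | IsLeaf G a}) hv.not_isLeaf]
  rfl

theorem Branching.weight_attachPath [Finite V] (hv : Branching G v) (hk : 2 ≤ k) :
    weight (attachPath G v k) = weight G + k + 2 := by
  rw [DisjDom.weight_attachPath hv.exists_adj hk, hv.weight_eq]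

theorem Branching.weight_add_two_le [Finite V] (hv : Branching G v) :
    weight G + 2 ≤ weight (attachPath G v 1) := by
  have h := Set.ncard_le_ncard (Set.subset_insert v (supportsAvoiding G v))
  rw [weight_attachPath_one hv.exists_adj, hv.weight_eq]
  omega

theorem weight_add_le_weight_attachPath_of_isLeaf [Finite V] (hv : IsLeaf G v) (hk : 2 ≤ k) :
    weight G + k ≤ weight (attachPath G v k) := by
  obtain ⟨u, hvu, hu⟩ := isLeaf_iff.1 hv
  have hleaves : ({a | IsLeaf G a} \ {v}).ncard + 1 = {a | IsLeaf G a}.ncard :=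
    Set.ncard_sdiff_singleton_add_one hv
  have hsupports : {a | IsSupport G a} ⊆ insert u (supportsAvoiding G v) := by
    rintro a ⟨w, haw, hw⟩
    rcases eq_or_ne w v with rfl | hwv
    · exact .inl (hu a haw.symm)
    · exact .inr ⟨w, haw, hw, hwv⟩
  have := (Set.ncard_le_ncard hsupports).trans (Set.ncard_insert_le _ _)
  rw [weight_attachPath ⟨u, hvu⟩ hk, weight, numLeaves, numSupports]
  omega

/-- The union of a set of old vertices and a set of vertices of the attached path. -/
def extend (D : Set V) (F : Set (Fin k)) : Set (V ⊕ Fin k) := Sum.inl '' D ∪ Sum.inr '' F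

@[simp] theorem inl_mem_extend {D : Set V} {F : Set (Fin k)} {a : V} :
    Sum.inl a ∈ extend D F ↔ a ∈ D := by simp [extend]

@[simp] theorem inr_mem_extend {D : Set V} {F : Set (Fin k)} {i : Fin k} :
    Sum.inr i ∈ extend D F ↔ i ∈ F := by simp [extend]

@[simp] theorem ncard_extend [Finite V] (D : Set V) (F : Set (Fin k)) :
    (extend D F).ncard = D.ncard + F.ncard := by
  rw [extend, Set.ncard_union_eq (Set.isCompl_range_inl_range_inr.disjoint.mono
    (Set.image_subset_range _ _) (Set.image_subset_range _ _)),
    Set.ncard_image_of_injective _ Sum.inl_injective,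
    Set.ncard_image_of_injective _ Sum.inr_injective]

theorem dominated_extend {D : Set V} {F : Set (Fin k)} (hD : ∀ a, Dominated G D a)
    (hF : ∀ i, Dominated (attachPath G v k) (extend D F) (.inr i)) (x : V ⊕ Fin k) :
    Dominated (attachPath G v k) (extend D F) x := by
  rcases x with a | i
  · exact (hD a).map (attachInl G v k).toHom Sum.inl_injective fun a ha => inl_mem_extend.2 ha
  · exact hF i

end attach

/-! ### Domination and attached paths -/

section

variable {V W : Type*} {G : SimpleGraph V} {H : SimpleGraph W} {v : V} {k : ℕ} {D : Set V}

/-- `v` lies in `D` or has two neighbours in `D`. This is what a dominating set `D` must satisfy in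
order to dominate a new leaf attached at `v`. -/
def StronglyDominated (G : SimpleGraph V) (D : Set V) (v : V) : Prop :=
  v ∈ D ∨ (D ∩ G.neighborSet v).Nontrivial

theorem StronglyDominated.extend (h : StronglyDominated G D v) (F : Set (Fin k)) :
    StronglyDominated (attachPath G v k) (extend D F) (.inl v) :=
  h.imp inl_mem_extend.2 fun hD => (hD.image Sum.inl_injective).mono <| by
    rintro _ ⟨a, ha, rfl⟩
    exact ⟨inl_mem_extend.2 ha.1, ha.2⟩

theorem dominated_extend_one (hD : ∀ a, Dominated G D a) (hv : StronglyDominated G D v)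
    (x : V ⊕ Fin 1) : Dominated (attachPath G v 1) (extend D ∅) x := by
  refine dominated_extend hD (fun i => ?_) x
  rcases hv with hv | ⟨a, ⟨ha, hva⟩, b, ⟨hb, hvb⟩, hab⟩
  · exact .inr (.inl ⟨.inl v, by simpa, by simp⟩)
  · exact .inr (.inr ⟨.inl a, by simpa, .inl b, by simpa, by simpa,
      ⟨.inl v, by simp, hva⟩, .inl v, by simp, hvb⟩)

theorem dominated_extend_two (hD : ∀ a, Dominated G D a) (x : V ⊕ Fin 2) :
    Dominated (attachPath G v 2) (extend D {0}) x := by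
  refine dominated_extend hD (fun i => ?_) x
  fin_cases i
  · exact .inl (by simp)
  · exact .inr (.inl ⟨.inr 0, by simp, by simp⟩)

theorem dominated_extend_three (hD : ∀ a, Dominated G D a) (x : V ⊕ Fin 3) :
    Dominated (attachPath G v 3) (extend D {1}) x := by
  refine dominated_extend hD (fun i => ?_) x
  fin_cases i
  · exact .inr (.inl ⟨.inr 1, by simp, by simp⟩)
  · exact .inl (by simp)
  · exact .inr (.inl ⟨.inr 1, by simp, by simp⟩)

theorem dominated_extend_four (hD : ∀ a, Dominated G D a) (hv : v ∈ D ∨ ∃ a ∈ D, G.Adj v a)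
    (x : V ⊕ Fin 4) : Dominated (attachPath G v 4) (extend D {2}) x := by
  refine dominated_extend hD (fun i => ?_) x
  fin_cases i
  · rcases hv with hv | ⟨a, ha, hva⟩
    · exact .inr (.inl ⟨.inl v, by simpa, by simp⟩)
    · exact .inr (.inr ⟨.inl a, by simpa, .inr 2, by simp, by simp,
        ⟨.inl v, by simp, hva⟩, .inr 1, by simp, by simp⟩)
  · exact .inr (.inl ⟨.inr 2, by simp, by simp⟩)
  · exact .inl (by simp)
  · exact .inr (.inl ⟨.inr 2, by simp, by simp⟩)

theorem StronglyDominated.mem_or_exists_adj (h : StronglyDominated G D v) :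
    v ∈ D ∨ ∃ a ∈ D, G.Adj v a :=
  h.imp_right fun hD => hD.nonempty

theorem dominated_extend_five (hD : ∀ a, Dominated G D a) (hv : v ∈ D) (x : V ⊕ Fin 5) :
    Dominated (attachPath G v 5) (extend D {3}) x := by
  refine dominated_extend hD (fun i => ?_) x
  fin_cases i
  · exact .inr (.inl ⟨.inl v, by simpa, by simp⟩)
  · exact .inr (.inr ⟨.inl v, by simpa, .inr 3, by simp, by simp,
      ⟨.inr 0, by simp, by simp⟩, .inr 2, by simp, by simp⟩)
  · exact .inr (.inl ⟨.inr 3, by simp, by simp⟩)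
  · exact .inl (by simp)
  · exact .inr (.inl ⟨.inr 3, by simp, by simp⟩)

theorem contract_of_adj_of_adj {a : V} {x y : V ⊕ Fin k} (hax : (attachPath G v k).Adj (.inl a) x)
    (hxy : (attachPath G v k).Adj x y) :
    (contract v y = a ∨ G.Adj a (contract v y)) ∨ ∃ b, y = .inl b ∧ ∃ z, G.Adj a z ∧ G.Adj z b := by
  rcases x with c | i <;> rcases y with b | j
  · exact .inr ⟨b, rfl, c, hax, hxy⟩
  all_goals simp_all [contract]

theorem dominated_contract_image {D : Set (V ⊕ Fin k)}
    (hD : ∀ x, Dominated (attachPath G v k) D x) (a : V) : Dominated G (contract v '' D) a := by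
  have of_near {y} (hy : y ∈ D) (h : contract v y = a ∨ G.Adj a (contract v y)) :
      Dominated G (contract v '' D) a :=
    h.imp (fun h => ⟨y, hy, h⟩) fun h => .inl ⟨_, ⟨y, hy, rfl⟩, h⟩
  rcases hD (.inl a) with ha | ⟨w, hw, haw⟩ |
    ⟨y, hy, z, hz, hyz, ⟨x, hax, hxy⟩, x', hax', hxz⟩
  · exact of_near ha (.inl rfl)
  · exact of_near hw ((adj_contract haw).imp_left Eq.symm)
  · rcases contract_of_adj_of_adj hax hxy with hnear | ⟨b, rfl, hb⟩
    · exact of_near hy hnear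
    rcases contract_of_adj_of_adj hax' hxz with hnear | ⟨c, rfl, hc⟩
    · exact of_near hz hnear
    exact .inr (.inr ⟨b, ⟨_, hy, rfl⟩, c, ⟨_, hz, rfl⟩, fun hbc => hyz (hbc ▸ rfl), hb, hc⟩)

theorem stronglyDominated_contract_image {D : Set (V ⊕ Fin 1)}
    (hD : ∀ x, Dominated (attachPath G v 1) D x) : StronglyDominated G (contract v '' D) v := by
  have adj_inr {x : V ⊕ Fin 1} (hx : (attachPath G v 1).Adj (.inr 0) x) : x = .inl v := by
    rcases x with a | i <;> simp_all
  have adj_inl {y : V ⊕ Fin 1} (hy : (attachPath G v 1).Adj (.inl v) y) :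
      contract v y = v ∨ ∃ b, y = .inl b ∧ G.Adj v b := by
    rcases y with b | i <;> simp_all [contract]
  rcases hD (.inr 0) with h | ⟨w, hw, hvw⟩ | ⟨y, hy, z, hz, hyz, ⟨x, hvx, hxy⟩, x', hvx', hxz⟩
  · exact .inl ⟨_, h, rfl⟩
  · exact .inl ⟨w, hw, adj_inr hvw ▸ rfl⟩
  · rcases adj_inl (adj_inr hvx ▸ hxy) with hv | ⟨b, rfl, hb⟩
    · exact .inl ⟨y, hy, hv⟩
    rcases adj_inl (adj_inr hvx' ▸ hxz) with hv | ⟨c, rfl, hc⟩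
    · exact .inl ⟨z, hz, hv⟩
    exact .inr ⟨b, ⟨⟨_, hy, rfl⟩, hb⟩, c, ⟨⟨_, hz, rfl⟩, hc⟩, fun hbc => hyz (hbc ▸ rfl)⟩

theorem mem_contract_image {D : Set (V ⊕ Fin 2)} (hD : ∀ x, Dominated (attachPath G v 2) D x) :
    v ∈ contract v '' D := by
  have contract_of_adj_inr {x y : V ⊕ Fin 2} (hx : (attachPath G v 2).Adj (.inr 1) x) :
      x = .inr 0 ∧ ((attachPath G v 2).Adj x y → contract v y = v) := by
    rcases x with a | i
    · simp at hx
    · obtain rfl : i = 0 := by simp at hx; omega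
      rcases y with b | j <;> simp_all [contract]
  rcases hD (.inr 1) with h | ⟨w, hw, hvw⟩ | ⟨y, hy, -, -, -, ⟨x, hvx, hxy⟩, -⟩
  · exact ⟨_, h, rfl⟩
  · exact ⟨w, hw, (contract_of_adj_inr (y := w) hvw).1 ▸ rfl⟩
  · exact ⟨y, hy, (contract_of_adj_inr hvx).2 hxy⟩

/-- The bound of the theorem for `G`, together with the part of the equality case that survives
the induction: in case of equality the graph decomposes into pieces. -/
def Bound (G : SimpleGraph V) : Prop :=
  4 * disjDomNumber G ≤ weight G ∧ (4 * disjDomNumber G = weight G → ∃ E, IsEndSet G E)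

theorem Bound.of_lt [Finite V] (hD : ∀ v, Dominated G D v) (h : 4 * D.ncard < weight G) :
    Bound G := by
  have := disjDomNumber_le_ncard hD
  exact ⟨by omega, fun _ => by omega⟩

theorem Bound.exists_dominating [Finite V] (h : Bound G) :
    ∃ D : Set V, (∀ v, Dominated G D v) ∧ 4 * D.ncard ≤ weight G := by
  obtain ⟨D, hD, hcard⟩ := exists_dominating_ncard_eq G
  exact ⟨D, hD, hcard ▸ h.1⟩

theorem Bound.congr [Finite V] (e : G ≃g H) (h : Bound G) : Bound H := by
  rw [Bound, ← weight_congr e, ← disjDomNumber_congr e]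
  exact ⟨h.1, fun heq => (h.2 heq).imp' (e.symm ⁻¹' ·) fun _ hE => hE.preimage e.symm⟩

variable [Finite V]

theorem Bound.exists_stronglyDominated (h : Bound (attachPath G v 1)) :
    ∃ D : Set V, (∀ a, Dominated G D a) ∧ StronglyDominated G D v ∧
      4 * D.ncard ≤ weight (attachPath G v 1) := by
  obtain ⟨D, hD, hcard⟩ := h.exists_dominating
  exact ⟨contract v '' D, dominated_contract_image hD, stronglyDominated_contract_image hD,
    (Nat.mul_le_mul_left 4 (Set.ncard_image_le D.toFinite)).trans hcard⟩

theorem Bound.exists_dominating_mem (h : Bound (attachPath G v 2)) :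
    ∃ D : Set V, (∀ a, Dominated G D a) ∧ v ∈ D ∧ 4 * D.ncard ≤ weight (attachPath G v 2) := by
  obtain ⟨D, hD, hcard⟩ := h.exists_dominating
  exact ⟨contract v '' D, dominated_contract_image hD, mem_contract_image hD,
    (Nat.mul_le_mul_left 4 (Set.ncard_image_le D.toFinite)).trans hcard⟩

end

/-! ### The bound and attached paths -/

section

variable {V : Type*} {G : SimpleGraph V} {v : V} {k : ℕ} {E : Set V}

theorem IsEndSet.existsUnique_mate_extend (h : IsEndSet G E) {F : Set (Fin k)}
    (hv : ∀ i : Fin k, i.val = 0 → (i ∈ F ↔ v ∈ E))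
    (hF : ∀ i : Fin k, ∃! j, (SimpleGraph.pathGraph k).Adj i j ∧ (j ∈ F ↔ i ∉ F)) (x : V ⊕ Fin k) :
    ∃! y, (attachPath G v k).Adj x y ∧ (y ∈ extend E F ↔ x ∉ extend E F) := by
  rcases x with a | i
  · obtain ⟨b, hab, hb⟩ := h.existsUnique_mate a
    refine ⟨.inl b, by simpa using hab, ?_⟩
    rintro (c | j) ⟨hc, hcE⟩
    · rw [hb c ⟨hc, by simpa using hcE⟩]
    · rw [inl_mem_extend, inr_mem_extend, hc.1, hv j hc.2] at hcE
      tauto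
  · obtain ⟨j, hij, hj⟩ := hF i
    refine ⟨.inr j, by simpa [SimpleGraph.pathGraph_adj] using hij, ?_⟩
    rintro (c | l) ⟨hc, hcE⟩
    · rw [inl_mem_extend, inr_mem_extend, hc.1, hv i hc.2] at hcE
      tauto
    · rw [hj l ⟨hc, by simpa using hcE⟩]

theorem isEndSet_pathGraph_four : IsEndSet (SimpleGraph.pathGraph 4) {1, 2} := by
  constructor <;>
    simp only [ExistsUnique, SimpleGraph.pathGraph_adj, Set.mem_insert_iff,
      Set.mem_singleton_iff] <;>
    decide

theorem IsEndSet.attach_two (h : IsEndSet G E) (hv : v ∈ E) :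
    IsEndSet (attachPath G v 2) (extend E {0}) where
  existsUnique_mate := h.existsUnique_mate_extend (by simp [hv])
    (by simp only [ExistsUnique, SimpleGraph.pathGraph_adj, Set.mem_singleton_iff]; decide)
  inner_unique := by
    rintro (c | i) hc (d | j) hd (d' | j') hd' hcd hcd' <;>
      simp only [inl_mem_extend, inr_mem_extend, Set.mem_singleton_iff, attachPath_inl_inl,
        attachPath_inl_inr, attachPath_inr_inl, attachPath_inr_inr] at *
    · rw [h.inner_unique c hc d hd d' hd' hcd hcd']
    all_goals omega
  exists_adj_end := by
    rintro (e | i) he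
    · obtain ⟨x, hx, hex⟩ := h.exists_adj_end e (by simpa using he)
      exact ⟨.inl x, by simpa using hx, hex⟩
    · exact ⟨.inl v, by simpa using hv, by simp_all⟩

theorem IsEndSet.attach_four (h : IsEndSet G E) (hv : IsLeaf G v) :
    IsEndSet (attachPath G v 4) (extend E {1, 2}) := by
  obtain ⟨hvE, hvd⟩ := h.isLeaf_iff.1 hv
  refine ⟨h.existsUnique_mate_extend (by simp [hvE]) isEndSet_pathGraph_four.existsUnique_mate,
    ?_, ?_⟩
  · rintro (c | i) hc (d | j) hd (d' | j') hd' hcd hcd' <;>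
      simp only [inl_mem_extend, inr_mem_extend, Set.mem_insert_iff, Set.mem_singleton_iff,
        attachPath_inl_inl, attachPath_inl_inr, attachPath_inr_inl, attachPath_inr_inr] at *
    · rw [h.inner_unique c hc d hd d' hd' hcd hcd']
    · exact absurd (hcd'.1 ▸ hcd) (hvd d hd)
    · exact absurd (hcd.1 ▸ hcd') (hvd d' hd')
    · rw [Fin.ext (hcd.2.trans hcd'.2.symm)]
    · rw [hcd.1, hcd'.1]
    all_goals omega
  · rintro (e | i) he
    · obtain ⟨x, hx, hex⟩ := h.exists_adj_end e (by simpa using he)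
      exact ⟨.inl x, by simpa using hx, hex⟩
    · obtain rfl | rfl : i = 1 ∨ i = 2 := by simpa using he
      · exact ⟨.inr 2, by simp, by simp⟩
      · exact ⟨.inr 1, by simp, by simp⟩

variable [Finite V]

theorem IsEndSet.disjDomNumber_attach_two_le (h : IsEndSet G E) (hG : G.IsTree) (hv : v ∉ E) :
    4 * disjDomNumber (attachPath G v 2) ≤ weight G := by
  have hcard := disjDomNumber_le_ncard (G := attachPath G v 2) (D := extend (h.upperEnds v) {0}) ?_
  · have hlt := h.ncard_upperEnds_lt hG hv
    rw [ncard_extend, Set.ncard_singleton] at hcard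
    rw [h.weight_eq]
    omega
  rintro (a | i)
  · have of_dominated (ha : Dominated G (h.upperEnds v) a) :=
      ha.map (attachInl G v 2).toHom Sum.inl_injective (D' := extend (h.upperEnds v) {0})
        fun a ha => inl_mem_extend.2 ha
    by_cases ha : a ∈ E
    · exact of_dominated (h.dominated_upperEnds_of_mem hG ha)
    rcases eq_or_ne a v with rfl | hav
    · exact .inr (.inl ⟨.inr 0, by simp, by simp⟩)
    by_cases hadj : G.Adj a v
    · have hmate : h.mate a ∈ E := h.mate_mem_iff.2 ha
      by_cases hupper : h.mate a ∈ h.upperEnds v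
      · exact of_dominated (.inr (.inl ⟨_, hupper, h.adj_mate a⟩))
      -- The neighbour `v` of `a` supplies the new vertex, the mate of `a` an upper end below it.
      obtain ⟨x, hx, hmx⟩ := h.exists_adj_end _ hmate
      exact .inr (.inr ⟨.inr 0, by simp, .inl x,
        by simpa using (h.mem_upperEnds_of_adj hG hmate hupper hx hmx).1, by simp,
        ⟨.inl v, hadj, by simp⟩, .inl (h.mate a), h.adj_mate a, hmx⟩)
    · exact of_dominated (h.dominated_upperEnds_of_notMem hG ha hav hadj)
  · fin_cases i
    · exact .inl (by simp)
    · exact .inr (.inl ⟨.inr 0, by simp, by simp⟩)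

theorem Bound.attach_two (hG : G.IsTree) (hv : Branching G v) (h : Bound G) :
    Bound (attachPath G v 2) := by
  obtain ⟨D, hD, hcard⟩ := exists_dominating_ncard_eq G
  have hle := disjDomNumber_le_ncard (dominated_extend_two (v := v) hD)
  have hweight := hv.weight_attachPath le_rfl
  have hbound := h.1
  rw [ncard_extend, Set.ncard_singleton] at hle
  refine ⟨by omega, fun heq => ?_⟩
  obtain ⟨E, hE⟩ := h.2 (by omega)
  refine ⟨_, hE.attach_two (v := v) ?_⟩
  by_contra hvE
  have := hE.disjDomNumber_attach_two_le hG hvE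
  omega

theorem Bound.attach_three (hv : Branching G v) (h : Bound G) : Bound (attachPath G v 3) := by
  obtain ⟨D, hD, hcard⟩ := h.exists_dominating
  refine .of_lt (dominated_extend_three (v := v) hD) ?_
  rw [ncard_extend, Set.ncard_singleton, hv.weight_attachPath (by norm_num)]
  omega

theorem Bound.attach_four {u x : V} (hv : IsLeaf G v) (hvu : G.Adj v u)
    (hu : ∀ y, G.Adj u y → y = v ∨ y = x) (h : Bound G) : Bound (attachPath G v 4) := by
  obtain ⟨D, hD, hcard⟩ := exists_dominating_ncard_eq G
  have hDv : v ∈ D ∨ ∃ a ∈ D, G.Adj v a := by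
    have eq_u {w} (hw : G.Adj v w) : w = u := (isLeaf_iff.1 hv).unique hw hvu
    rcases hD v with hvD | hadj | ⟨a, ha, b, hb, hab, ⟨y, hvy, hya⟩, z, hvz, hzb⟩
    · exact .inl hvD
    · exact .inr hadj
    · rcases hu a (eq_u hvy ▸ hya) with rfl | rfl
      · exact .inl ha
      · rcases hu b (eq_u hvz ▸ hzb) with rfl | rfl
        · exact .inl hb
        · exact absurd rfl hab
  have hle := disjDomNumber_le_ncard (dominated_extend_four hD hDv)
  have hweight := weight_add_le_weight_attachPath_of_isLeaf hv (k := 4) (by norm_num)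
  have hbound := h.1
  rw [ncard_extend, Set.ncard_singleton] at hle
  exact ⟨by omega, fun heq => (h.2 (by omega)).imp' _ fun _ hE => hE.attach_four hv⟩

theorem Bound.attach_six (h : Bound (attachPath G v 2)) : Bound (attachPath G v 6) := by
  refine .congr (attachAppend G v 1 4) (h.attach_four (u := .inr 0) (x := .inl v)
    ((isLeaf_inr_iff _).2 rfl) (by simp) ?_)
  rintro (a | i) hi
  · exact .inr (congrArg _ (attachPath_inr_inl.1 hi).1)
  · exact .inl (congrArg _ (Fin.ext (by simpa [eq_comm] using hi)))

theorem Bound.attach_one_one (hv : ∃ w, G.Adj v w) (h : Bound (attachPath G v 1)) :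
    Bound (attachPath (attachPath G v 1) (.inl v) 1) := by
  obtain ⟨D, hD, hDv, hcard⟩ := h.exists_stronglyDominated
  refine .of_lt (dominated_extend_one (dominated_extend_one hD hDv) (hDv.extend _)) ?_
  have := (branching_inl hv one_pos).weight_add_two_le
  simp only [ncard_extend, Set.ncard_empty]
  omega

theorem Bound.attach_one_four (hv : ∃ w, G.Adj v w) (h : Bound (attachPath G v 1)) :
    Bound (attachPath (attachPath G v 1) (.inl v) 4) := by
  obtain ⟨D, hD, hDv, hcard⟩ := h.exists_stronglyDominated
  refine .of_lt (dominated_extend_four (dominated_extend_one hD hDv)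
    (hDv.extend _).mem_or_exists_adj) ?_
  have := (branching_inl hv one_pos).weight_attachPath (k := 4) (by norm_num)
  simp only [ncard_extend, Set.ncard_empty, Set.ncard_singleton]
  omega

theorem Bound.attach_four_four (hv : ∃ w, G.Adj v w) (h : Bound (attachPath G v 1)) :
    Bound (attachPath (attachPath G v 4) (.inl v) 4) := by
  obtain ⟨D, hD, hDv, hcard⟩ := h.exists_stronglyDominated
  refine .of_lt (dominated_extend_four (dominated_extend_four hD hDv.mem_or_exists_adj)
    (hDv.extend _).mem_or_exists_adj) ?_
  have hweight := weight_attachPath_one_add_le hv (k := 4) (by norm_num)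
  have := (branching_inl hv four_pos).weight_attachPath (k := 4) (by norm_num)
  simp only [ncard_extend, Set.ncard_singleton]
  omega

theorem Bound.attach_five_one (hv : ∃ w, G.Adj v w) (h : Bound (attachPath G v 2)) :
    Bound (attachPath (attachPath G v 5) (.inl v) 1) := by
  obtain ⟨D, hD, hDv, hcard⟩ := h.exists_dominating_mem
  refine .of_lt (dominated_extend_one (dominated_extend_five hD hDv)
    (.inl (inl_mem_extend.2 hDv))) ?_
  have := (branching_inl hv (k := 5) (by norm_num)).weight_add_two_le
  have := weight_attachPath hv (k := 5) (by norm_num)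
  rw [weight_attachPath hv le_rfl] at hcard
  simp only [ncard_extend, Set.ncard_empty, Set.ncard_singleton]
  omega

theorem Bound.attach_five_four (hv : ∃ w, G.Adj v w) (h : Bound (attachPath G v 2)) :
    Bound (attachPath (attachPath G v 5) (.inl v) 4) := by
  obtain ⟨D, hD, hDv, hcard⟩ := h.exists_dominating_mem
  refine .of_lt (dominated_extend_four (dominated_extend_five hD hDv)
    (.inl (inl_mem_extend.2 hDv))) ?_
  have := (branching_inl hv (k := 5) (by norm_num)).weight_attachPath (k := 4) (by norm_num)
  have := weight_attachPath hv (k := 5) (by norm_num)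
  rw [weight_attachPath hv le_rfl] at hcard
  simp only [ncard_extend, Set.ncard_singleton]
  omega

theorem Bound.attach_five_five (hv : ∃ w, G.Adj v w) (h : Bound (attachPath G v 2)) :
    Bound (attachPath (attachPath G v 5) (.inl v) 5) := by
  obtain ⟨D, hD, hDv, hcard⟩ := h.exists_dominating_mem
  refine .of_lt (dominated_extend_five (dominated_extend_five hD hDv)
    (inl_mem_extend.2 hDv)) ?_
  have := (branching_inl hv (k := 5) (by norm_num)).weight_attachPath (k := 5) (by norm_num)
  have := weight_attachPath hv (k := 5) (by norm_num)
  rw [weight_attachPath hv le_rfl] at hcard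
  simp only [ncard_extend, Set.ncard_singleton]
  omega

end

/-! ### Legs -/

section

variable {V W : Type*} {T : SimpleGraph V} {G : SimpleGraph W} {v : W} {p q x y : V} {k l : ℕ}

/-- A leg of length `k` at `p` starting with `x`: an attached path with `k` vertices whose first
vertex `x` is adjacent to `p`. The length of a longer leg is written `1 + k` to match the
isomorphism `attachAppend`. -/
inductive HasLeg (T : SimpleGraph V) : V → V → ℕ → Prop
  | one {p x : V} : T.Adj p x → (∀ y, T.Adj x y → y = p) → HasLeg T p x 1
  | cons {p x y : V} {k : ℕ} : HasLeg T x y k → T.Adj p x → p ≠ y →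
      (∀ z, T.Adj x z → z = p ∨ z = y) → HasLeg T p x (1 + k)

theorem HasLeg.adj (h : HasLeg T p x k) : T.Adj p x := by
  cases h <;> assumption

theorem HasLeg.pos (h : HasLeg T p x k) : 0 < k := by
  cases h <;> omega

theorem HasLeg.map (e : T ≃g G) (h : HasLeg T p x k) : HasLeg G (e p) (e x) k := by
  induction h with
  | one hadj hx =>
    refine .one (e.map_adj_iff.2 hadj) fun y hy => ?_
    obtain ⟨y, rfl⟩ := e.surjective y
    rw [hx y (e.map_adj_iff.1 hy)]
  | cons _ hadj hne hx ih =>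
    refine .cons ih (e.map_adj_iff.2 hadj) (e.injective.ne hne) fun z hz => ?_
    obtain ⟨z, rfl⟩ := e.surjective z
    exact (hx z (e.map_adj_iff.1 hz)).imp (congrArg e) (congrArg e)

theorem HasLeg.of_attachPath (hv : Branching G v) (hl : 0 < l) {p x : W}
    (h : HasLeg (attachPath G v l) (.inl p) (.inl x) k) : HasLeg G p x k := by
  generalize hp : Sum.inl p = p', hx : Sum.inl x = x' at h
  induction h generalizing p x with
  | one hadj huniq =>
    subst hp hx
    exact .one hadj fun y hy => Sum.inl_injective (huniq (.inl y) hy)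
  | @cons _ _ y' k h hadj hne hor ih =>
    subst hp hx
    have hxv : x ≠ v := by
      rintro rfl
      obtain ⟨a, ha, b, hb, hab⟩ := hv
      have ha' := hor (.inl a) ha
      have hb' := hor (.inl b) hb
      have hnew := hor (.inr ⟨0, hl⟩) (by simp)
      grind
    rcases y' with y | j
    · exact .cons (ih rfl rfl) hadj (fun hpy => hne (congrArg _ hpy)) fun z hz =>
        (hor (.inl z) hz).imp (Sum.inl_injective ·) (Sum.inl_injective ·)
    · exact absurd h.adj.1 hxv

end

section

variable {V : Type u} [Finite V] {T : SimpleGraph V} {p q x y : V} {k l : ℕ}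

theorem exists_attachPath_one_iso (hadj : T.Adj p x) (hx : ∀ y, T.Adj x y → y = p) :
    ∃ (W : Type u) (_ : Finite W) (G : SimpleGraph W) (v : W) (e : attachPath G v 1 ≃g T),
      e (.inl v) = p ∧ e (.inr 0) = x := by
  let f : {y // y ≠ x} ⊕ Fin 1 → V := Sum.elim Subtype.val fun _ => x
  have hf : Function.Bijective f := by
    constructor
    · rintro (a | i) (b | j) hab
      · exact congrArg _ (Subtype.ext hab)
      · exact absurd hab a.2
      · exact absurd hab.symm b.2
      · rw [Subsingleton.elim i j]
    · intro y
      by_cases hy : y = x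
      · exact ⟨.inr 0, hy.symm⟩
      · exact ⟨.inl ⟨y, hy⟩, rfl⟩
  have adj_x {y : V} : T.Adj y x ↔ y = p := ⟨fun h => hx y h.symm, fun h => h ▸ hadj⟩
  refine ⟨{y // y ≠ x}, inferInstance, T.induce {y | y ≠ x}, ⟨p, hadj.ne⟩,
    ⟨Equiv.ofBijective f hf, ?_⟩, rfl, rfl⟩
  rintro (a | i) (b | j)
  · rfl
  · simp [f, adj_x, Subtype.ext_iff]
  · simp [f, adj_x, T.adj_comm x, Subtype.ext_iff]
  · simp [f]

theorem HasLeg.exists_iso (h : HasLeg T p x k) :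
    ∃ (W : Type u) (_ : Finite W) (G : SimpleGraph W) (v : W) (hk : 0 < k)
      (e : attachPath G v k ≃g T), e (.inl v) = p ∧ e (.inr ⟨0, hk⟩) = x := by
  induction h with
  | one hadj hx =>
    obtain ⟨W, _, G, v, e, hp, hx⟩ := exists_attachPath_one_iso hadj hx
    exact ⟨W, ‹_›, G, v, one_pos, e, hp, hx⟩
  | @cons p x y k h hadj hne hor ih =>
    obtain ⟨W, _, G, v, hk, e, rfl, rfl⟩ := ih
    obtain ⟨p | i, rfl⟩ := e.surjective p
    · have hadj' : G.Adj p v := e.map_adj_iff.1 hadj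
      have huniq : ∀ z, G.Adj v z → z = p := fun z hz => by
        rcases hor _ (e.map_adj_iff.2 (attachPath_inl_inl.2 hz)) with hz | hz
        · exact Sum.inl_injective (e.injective hz)
        · simpa using e.injective hz
      obtain ⟨W', _, G', v', e', rfl, rfl⟩ := exists_attachPath_one_iso hadj' huniq
      exact ⟨W', ‹_›, G', v', by omega,
        (attachAppend G' v' 0 k).symm.trans ((attachCongr e' (.inr 0) k).trans e), rfl, rfl⟩
    · have hi := (e.map_adj_iff.1 hadj).2
      exact absurd (congrArg e (congrArg _ (Fin.ext hi))) hne

theorem HasLeg.exists_iso_attach_attach (hx : HasLeg T p x k) (hy : HasLeg T p y l) (hxy : x ≠ y)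
    (hpq : T.Adj p q) (hqx : q ≠ x) (hqy : q ≠ y) :
    ∃ (W : Type u) (_ : Finite W) (G : SimpleGraph W) (v : W),
      (∃ w, G.Adj v w) ∧ Nonempty (attachPath (attachPath G v k) (.inl v) l ≃g T) := by
  obtain ⟨W, _, G, v, hl, e, rfl, rfl⟩ := hy.exists_iso
  have exists_inl {z : V} (hz : T.Adj (e (.inl v)) z) (hne : z ≠ e (.inr ⟨0, hl⟩)) :
      ∃ a, G.Adj v a ∧ e (.inl a) = z := by
    obtain ⟨a | i, rfl⟩ := e.surjective z
    · exact ⟨a, e.map_adj_iff.1 hz, rfl⟩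
    · exact absurd (congrArg e (congrArg _ (Fin.ext (e.map_adj_iff.1 hz).2))) hne
  obtain ⟨a, hva, rfl⟩ := exists_inl hx.adj hxy
  obtain ⟨b, hvb, rfl⟩ := exists_inl hpq hqy
  have hba : b ≠ a := fun hba => hqx (hba ▸ rfl)
  have hleg : HasLeg G v a k := by
    refine HasLeg.of_attachPath ⟨a, hva, b, hvb, hba.symm⟩ hl ?_
    simpa using hx.map e.symm
  obtain ⟨W', _, G', v', hk, e', rfl, rfl⟩ := hleg.exists_iso
  refine ⟨W', ‹_›, G', v', ?_, ⟨(attachCongr e' (.inl v') l).trans e⟩⟩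
  obtain ⟨c | i, rfl⟩ := e'.surjective b
  · exact ⟨c, e'.map_adj_iff.1 hvb⟩
  · exact absurd (congrArg e' (congrArg _ (Fin.ext (e'.map_adj_iff.1 hvb).2))) hba

end

/-! ### Proof of the bound -/

section

variable {V : Type*} {G : SimpleGraph V} {v : V} {k : ℕ}

theorem isLeaf_inl_of_unique [Unique V] (hk : 0 < k) : IsLeaf (attachPath G v k) (.inl v) := by
  refine isLeaf_iff.2 ⟨.inr ⟨0, hk⟩, by simp, ?_⟩
  rintro (a | i) h
  · exact absurd (Subsingleton.elim v a) (G.ne_of_adj h)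
  · exact congrArg _ (Fin.ext h.2)

theorem card_add_le_weight_attachPath [Unique V] (hk : 0 < k) :
    k + 4 ≤ weight (attachPath G v k) := by
  have hsupport : IsSupport (attachPath G v k) (.inr ⟨0, hk⟩) :=
    ⟨.inl v, by simp, isLeaf_inl_of_unique hk⟩
  have hlast : IsLeaf (attachPath G v k) (.inr ⟨k - 1, by omega⟩) :=
    (isLeaf_inr_iff _).2 (by simp; omega)
  have hleaves : 2 ≤ numLeaves (attachPath G v k) :=
    (Set.one_lt_ncard (Set.toFinite _)).2 ⟨_, isLeaf_inl_of_unique hk, _, hlast, by simp⟩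
  have hsupports : 0 < numSupports (attachPath G v k) :=
    (Set.ncard_pos (Set.toFinite _)).2 ⟨_, hsupport⟩
  have hcard : Nat.card (V ⊕ Fin k) = 1 + k := by simp
  rw [weight]
  omega

theorem card_add_lt_weight_attachPath [Unique V] (hk : 3 ≤ k) :
    k + 4 < weight (attachPath G v k) := by
  have hfirst : IsSupport (attachPath G v k) (.inr ⟨0, by omega⟩) :=
    ⟨.inl v, by simp, isLeaf_inl_of_unique (by omega)⟩
  have hlast : IsLeaf (attachPath G v k) (.inr ⟨k - 1, by omega⟩) :=
    (isLeaf_inr_iff _).2 (by simp; omega)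
  have hsecond : IsSupport (attachPath G v k) (.inr ⟨k - 2, by omega⟩) :=
    ⟨_, by simp; omega, hlast⟩
  have hleaves : 2 ≤ numLeaves (attachPath G v k) :=
    (Set.one_lt_ncard (Set.toFinite _)).2
      ⟨_, isLeaf_inl_of_unique (by omega), _, hlast, by simp⟩
  have hsupports : 2 ≤ numSupports (attachPath G v k) :=
    (Set.one_lt_ncard (Set.toFinite _)).2 ⟨_, hfirst, _, hsecond, by simp; omega⟩
  have hcard : Nat.card (V ⊕ Fin k) = 1 + k := by simp
  rw [weight]
  omega

theorem Bound.attach_of_unique [Unique V] (hk : 0 < k) (hk5 : k ≤ 5) :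
    Bound (attachPath G v k) := by
  have hV (a : V) : Dominated G {v} a := .inl (Subsingleton.elim a v)
  have hweight := card_add_le_weight_attachPath (G := G) (v := v) hk
  have hweight' := card_add_lt_weight_attachPath (G := G) (v := v) (k := k)
  interval_cases k
  · exact .of_lt (dominated_extend_one hV (.inl rfl)) (by simp; omega)
  · refine .of_lt (D := extend ∅ {0}) ?_ (by simp; omega)
    rintro (a | i)
    · exact .inr (.inl ⟨.inr 0, by simp, by simp [Subsingleton.elim a v]⟩)
    · fin_cases i
      · exact .inl (by simp)
      · exact .inr (.inl ⟨.inr 0, by simp, by simp⟩)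
  · have hle := disjDomNumber_le_ncard (dominated_extend_three (v := v) hV)
    rw [ncard_extend, Set.ncard_singleton, Set.ncard_singleton] at hle
    exact ⟨by omega, fun _ => ⟨_, isEndSet_pathGraph_four.preimage (attachIsoPathGraph G v 3)⟩⟩
  · exact .of_lt (dominated_extend_four hV (.inl rfl)) (by simp; omega)
  · exact .of_lt (dominated_extend_five hV rfl) (by simp; omega)

theorem Bound.attach_attach [Finite V] {l : ℕ} (hT : (attachPath G v k).IsTree)
    (hv : ∃ w, G.Adj v w) (h : ∀ j ∈ Set.Icc 1 k, Bound (attachPath G v j))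
    (hk : k ∈ Set.Icc 1 5) (hl : l ∈ Set.Icc 1 5)
    (hkl : (l = 2 ∨ l = 3) ∨ k = l ∨ k = 5 ∨ (k = 1 ∧ l = 4)) :
    Bound (attachPath (attachPath G v k) (.inl v) l) := by
  have branching : Branching (attachPath G v k) (.inl v) := branching_inl hv hk.1
  have bound := h k ⟨hk.1, le_rfl⟩
  have bound_one := h 1 ⟨le_rfl, hk.1⟩
  obtain ⟨hk1, hk5⟩ := hk
  obtain ⟨hl1, hl5⟩ := hl
  rcases hkl with (rfl | rfl) | rfl | rfl | ⟨rfl, rfl⟩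
  · exact bound.attach_two hT branching
  · exact bound.attach_three branching
  · interval_cases k
    · exact bound_one.attach_one_one hv
    · exact bound.attach_two hT branching
    · exact bound.attach_three branching
    · exact bound_one.attach_four_four hv
    · exact (h 2 (by norm_num)).attach_five_five hv
  · have bound_two := h 2 (by norm_num)
    interval_cases l
    · exact bound_two.attach_five_one hv
    · exact bound.attach_two hT branching
    · exact bound.attach_three branching
    · exact bound_two.attach_five_four hv
    · exact bound_two.attach_five_five hv
  · exact bound_one.attach_one_four hv

/-- Two paths attached at the same vertex can be interchanged. -/
def attachSwap (G : SimpleGraph V) (v : V) (k l : ℕ) :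
    attachPath (attachPath G v k) (.inl v) l ≃g attachPath (attachPath G v l) (.inl v) k where
  toEquiv := (Equiv.sumAssoc _ _ _).trans
    (((Equiv.refl _).sumCongr (Equiv.sumComm _ _)).trans (Equiv.sumAssoc _ _ _).symm)
  map_rel_iff' := by rintro ((a | i) | i) ((b | j) | j) <;> simp

end

section

/-- The induction hypothesis: the bound holds for all nontrivial trees with fewer than `n`
vertices. -/
def BoundBelow (n : ℕ) : Prop :=
  ∀ (W : Type u) [Finite W] [Nontrivial W] (G : SimpleGraph W), G.IsTree → Nat.card W < n → Bound G

variable {V : Type u} [Finite V] {T : SimpleGraph V} {p q x y : V} {k l : ℕ}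

theorem BoundBelow.bound_attach_attach {v : V} (hv : ∃ w, T.Adj v w)
    (h : (attachPath (attachPath T v k) (.inl v) l).IsTree)
    (ih : BoundBelow.{u} (Nat.card ((V ⊕ Fin k) ⊕ Fin l)))
    (hk : k ∈ Set.Icc 1 5) (hl : l ∈ Set.Icc 1 5) :
    Bound (attachPath (attachPath T v k) (.inl v) l) := by
  wlog hkl : (l = 2 ∨ l = 3) ∨ k = l ∨ k = 5 ∨ (k = 1 ∧ l = 4) generalizing k l
  · refine (this ((attachSwap T v k l).isTree_iff.1 h) ?_ hl hk ?_).congr (attachSwap T v l k)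
    · rwa [Nat.card_congr (attachSwap T v l k).toEquiv]
    · simp only [Set.mem_Icc] at hk hl
      omega
  have hk' : (attachPath T v k).IsTree := isTree_of_attachPath h
  refine .attach_attach hk' hv (fun j hj => ?_) hk hl hkl
  have : Nontrivial (V ⊕ Fin j) := let ⟨w, hw⟩ := hv; ⟨.inl v, .inl w, by simpa using hw.ne⟩
  refine ih _ _ (isTree_attachPath_of_le hk' hj.2) ?_
  simp only [Nat.card_sum, Nat.card_fin]
  have := hj.2
  have := hl.1
  omega

theorem BoundBelow.bound_of_hasLeg_of_hasLeg (ih : BoundBelow.{u} (Nat.card V)) (hT : T.IsTree)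
    (hx : HasLeg T p x k) (hy : HasLeg T p y l) (hk : k ≤ 5) (hl : l ≤ 5) (hxy : x ≠ y)
    (hpq : T.Adj p q) (hqx : q ≠ x) (hqy : q ≠ y) : Bound T := by
  obtain ⟨W, _, G, v, hv, ⟨e⟩⟩ := hx.exists_iso_attach_attach hy hxy hpq hqx hqy
  refine (BoundBelow.bound_attach_attach hv (e.isTree_iff.2 hT) ?_ ⟨hx.pos, hk⟩
    ⟨hy.pos, hl⟩).congr e
  rwa [Nat.card_congr e.toEquiv]

theorem BoundBelow.bound_of_hasLeg_six (ih : BoundBelow.{u} (Nat.card V)) (hT : T.IsTree)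
    (h : HasLeg T p x 6) : Bound T := by
  obtain ⟨W, _, G, v, _, e, -, -⟩ := h.exists_iso
  have hcard := Nat.card_congr e.toEquiv
  have : Nontrivial (W ⊕ Fin 2) := ⟨.inr 0, .inr 1, by simp⟩
  refine (ih _ _ (isTree_attachPath_of_le (e.isTree_iff.2 hT) (by norm_num)) ?_).attach_six.congr e
  simp only [Nat.card_sum, Nat.card_fin] at hcard ⊢
  omega

theorem BoundBelow.exists_hasLeg (ih : BoundBelow.{u} (Nat.card V)) (hT : T.IsTree)
    (hbound : ¬ Bound T) {r : V} (hadj : T.Adj x p) (hd : T.dist r x = T.dist r p + 1) :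
    ∃ k ≤ 5, HasLeg T p x k := by
  obtain ⟨M, hM⟩ := (Set.finite_range (T.dist r)).bddAbove
  induction hn : M - T.dist r x generalizing p x with
  | zero =>
    refine ⟨1, by norm_num, .one hadj.symm fun y hy => ?_⟩
    by_contra hne
    have := dist_eq_add_one_of_adj_of_ne hT hadj hd hy hne
    have := hM (Set.mem_range_self y)
    omega
  | succ n ihn =>
    have child_hasLeg {y : V} (hy : T.Adj x y) (hne : y ≠ p) : ∃ k ≤ 5, HasLeg T x y k :=
      have hdy := dist_eq_add_one_of_adj_of_ne hT hadj hd hy hne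
      ihn hy.symm hdy (by omega)
    by_cases hchild : ∃ y, T.Adj x y ∧ y ≠ p
    · obtain ⟨y, hy, hyp⟩ := hchild
      obtain ⟨k, hk, hleg⟩ := child_hasLeg hy hyp
      have hother : ∀ z, T.Adj x z → z = p ∨ z = y := by
        by_contra! ⟨z, hz, hzp, hzy⟩
        obtain ⟨l, hl, hleg'⟩ := child_hasLeg hz hzp
        exact hbound (ih.bound_of_hasLeg_of_hasLeg hT hleg hleg' hk hl hzy.symm hadj
          hyp.symm hzp.symm)
      have hleg' := HasLeg.cons hleg hadj.symm hyp.symm hother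
      have hk5 : k ≠ 5 := by
        rintro rfl
        exact hbound (ih.bound_of_hasLeg_six hT hleg')
      exact ⟨1 + k, by omega, hleg'⟩
    · exact ⟨1, by norm_num, .one hadj.symm (by simpa using hchild)⟩

theorem bound_of_hasLeg_of_isLeaf (hT : T.IsTree) (hp : IsLeaf T p) (h : HasLeg T p x k)
    (hk : k ≤ 5) : Bound T := by
  obtain ⟨W, _, G, v, hpos, e, rfl, rfl⟩ := h.exists_iso
  have hG : G.Connected := connected_of_attachPath (e.isTree_iff.2 hT).connected
  have hsub : ∀ a, a = v := fun a => by
    by_contra hne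
    obtain ⟨b, hb, -⟩ := exists_adj_dist_eq_add_one hG (Ne.symm hne)
    have := (isLeaf_iff.1 hp).unique (e.map_adj_iff.2 (attachPath_inl_inl.2 hb)) h.adj
    simpa using e.injective this
  have : Unique W := ⟨⟨v⟩, hsub⟩
  exact (Bound.attach_of_unique hpos hk).congr e

theorem bound_of_isTree (V : Type u) [Finite V] [Nontrivial V] (T : SimpleGraph V)
    (hT : T.IsTree) : Bound T := by
  induction hn : Nat.card V using Nat.strong_induction_on generalizing V with
  | _ n ih =>
    have ih : BoundBelow.{u} (Nat.card V) := fun W _ _ G hG hW => ih _ (hn ▸ hW) W G hG rfl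
    by_contra hbound
    have hr : ∃ r, IsLeaf T r := by
      classical
      have := Fintype.ofFinite V
      obtain ⟨r, hr⟩ := hT.exists_vert_degree_one_of_nontrivial
      exact ⟨r, isLeaf_iff.2 (SimpleGraph.degree_eq_one_iff_existsUnique_adj.1 hr)⟩
    obtain ⟨r, hr⟩ := hr
    obtain ⟨x, hrx, -⟩ := isLeaf_iff.1 hr
    obtain ⟨k, hk, hleg⟩ := ih.exists_hasLeg hT hbound (r := r) hrx.symm (by
      simp [SimpleGraph.dist_eq_one_iff_adj.2 hrx])
    exact hbound (bound_of_hasLeg_of_isLeaf hT hr hleg hk)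

end

/-! ### Labels and end sets of members of `𝒯₂` -/

section

variable {V W : Type*} {G : SimpleGraph V} {H : SimpleGraph W} {S : V → Status} {E : Set V}
  {v : V} {k : ℕ}

/-- The labeling `S` is compatible with the end set `E`: the pieces of a member of `𝒯₂` are the
edges labeled `AC` with a leaf and the paths labeled `A C D B`. -/
structure Labeled (G : SimpleGraph V) (S : V → Status) (E : Set V) : Prop where
  pair : ∀ e ∈ E, ∀ c ∉ E, G.Adj e c → (S e = .A ∧ S c = .C) ∨ (S e = .B ∧ S c = .D)
  leaf : ∀ c, IsLeaf G c → S c = .C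
  link : ∀ c ∉ E, ∀ d ∉ E, G.Adj c d → S c ≠ S d

theorem Labeled.preimage (e : G ≃g H) {S : W → Status} {E : Set W} (h : Labeled H S E) :
    Labeled G (fun v => S (e v)) (e ⁻¹' E) where
  pair _ hx _ hc hxc := h.pair _ hx _ hc (e.map_adj_iff.2 hxc)
  leaf _ hc := h.leaf _ ((isLeaf_apply_iff e).2 hc)
  link _ hc _ hd hcd := h.link _ hc _ hd (e.map_adj_iff.2 hcd)

theorem Labeled.mem_iff (h : Labeled G S E) (hE : IsEndSet G E) {x : V} :
    x ∈ E ↔ S x = .A ∨ S x = .B := by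
  constructor
  · intro hx
    exact (h.pair x hx _ (hE.mate_notMem hx) (hE.adj_mate x)).imp And.left And.left
  · contrapose
    intro hx
    rcases h.pair _ (hE.mate_mem_iff.2 hx) x hx (hE.adj_mate x).symm with hS | hS <;> simp [hS.2]

theorem Labeled.notMem_iff (h : Labeled G S E) (hE : IsEndSet G E) {x : V} :
    x ∉ E ↔ S x = .C ∨ S x = .D := by
  rw [h.mem_iff hE]
  cases S x <;> simp

theorem isTight_pathGraph_four : IsTight (SimpleGraph.pathGraph 4) {1, 2} where
  toIsEndSet := isEndSet_pathGraph_four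
  exists_small c hc := by
    have small_end : ∀ e, SmallEnd (SimpleGraph.pathGraph 4) {1, 2} e := by
      rintro e x ⟨hx, hex⟩ y ⟨hy, hey⟩
      simp only [Set.mem_insert_iff, Set.mem_singleton_iff, SimpleGraph.pathGraph_adj] at *
      omega
    obtain rfl | rfl : c = 0 ∨ c = 3 := by
      rw [Set.mem_insert_iff, Set.mem_singleton_iff] at hc
      omega
    · exact ⟨0, hc, .inl rfl, 1, by simp, by simp [SimpleGraph.pathGraph_adj], small_end 1⟩
    · exact ⟨3, hc, .inl rfl, 2, by simp, by simp [SimpleGraph.pathGraph_adj], small_end 2⟩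

theorem labeled_pathGraph_four :
    Labeled (SimpleGraph.pathGraph 4) ![Status.C, .A, .A, .C] {1, 2} where
  pair e he c hc hec := by
    simp only [Set.mem_insert_iff, Set.mem_singleton_iff, SimpleGraph.pathGraph_adj] at *
    fin_cases e <;> fin_cases c <;> simp_all
  leaf c hc := by
    have hcE := (isEndSet_pathGraph_four.isLeaf_iff.1 hc).1
    fin_cases c <;> simp_all
  link c hc d hd hcd := by
    simp only [Set.mem_insert_iff, Set.mem_singleton_iff, SimpleGraph.pathGraph_adj] at *
    omega

theorem isLeaf_of_inl (hE : IsEndSet G E) {F : Set (Fin k)}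
    (hEF : IsEndSet (attachPath G v k) (extend E F)) {a : V}
    (ha : IsLeaf (attachPath G v k) (.inl a)) : IsLeaf G a := by
  rw [hEF.isLeaf_iff, inl_mem_extend] at ha
  exact hE.isLeaf_iff.2 ⟨ha.1, fun d hd had => ha.2 (.inl d) (by simpa using hd) had⟩

theorem Labeled.attach_two (h : Labeled G S E) (hE : IsEndSet G E) (hv : v ∈ E) :
    Labeled (attachPath G v 2) (Sum.elim S ![Status.A, .C]) (extend E {0}) where
  pair := by
    rintro (e | i) he (c | j) hc hec <;>
      simp only [inl_mem_extend, inr_mem_extend, Set.mem_singleton_iff, attachPath_inl_inl,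
        attachPath_inl_inr, attachPath_inr_inl, attachPath_inr_inr] at he hc hec
    · exact h.pair e he c hc hec
    · omega
    · exact absurd hv (hec.1 ▸ hc)
    · obtain ⟨rfl, rfl⟩ : i = 0 ∧ j = 1 := by omega
      exact .inl ⟨rfl, rfl⟩
  leaf := by
    rintro (a | i) ha
    · exact h.leaf a (isLeaf_of_inl hE (hE.attach_two hv) ha)
    · obtain rfl : i = 1 := by
        have hi := ((hE.attach_two hv).isLeaf_iff.1 ha).1
        rw [inr_mem_extend, Set.mem_singleton_iff] at hi
        omega
      rfl
  link := by
    rintro (c | i) hc (d | j) hd hcd <;>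
      simp only [inl_mem_extend, inr_mem_extend, Set.mem_singleton_iff, attachPath_inl_inl,
        attachPath_inl_inr, attachPath_inr_inl, attachPath_inr_inr] at hc hd hcd
    · exact h.link c hc d hd hcd
    · exact absurd hv (hcd.1 ▸ hc)
    · exact absurd hv (hcd.1 ▸ hd)
    · omega

theorem Labeled.attach_four (h : Labeled G S E) (hE : IsEndSet G E) (hv : IsLeaf G v) :
    Labeled (attachPath G v 4) (Sum.elim S ![Status.D, .B, .A, .C]) (extend E {1, 2}) where
  pair := by
    have hvE := (hE.isLeaf_iff.1 hv).1
    rintro (e | i) he (c | j) hc hec <;>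
      simp only [inl_mem_extend, inr_mem_extend, Set.mem_insert_iff, Set.mem_singleton_iff,
        attachPath_inl_inl, attachPath_inl_inr, attachPath_inr_inl, attachPath_inr_inr]
        at he hc hec
    · exact h.pair e he c hc hec
    · exact absurd he (hec.1 ▸ hvE)
    · omega
    · obtain ⟨rfl, rfl⟩ | ⟨rfl, rfl⟩ : (i = 1 ∧ j = 0) ∨ (i = 2 ∧ j = 3) := by omega
      · exact .inr ⟨rfl, rfl⟩
      · exact .inl ⟨rfl, rfl⟩
  leaf := by
    rintro (a | i) ha
    · exact h.leaf a (isLeaf_of_inl hE (hE.attach_four hv) ha)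
    · obtain ⟨hi, hadj⟩ := (hE.attach_four hv).isLeaf_iff.1 ha
      have hi0 : i.val ≠ 0 := fun hi0 =>
        hadj (.inl v) (by simpa using (hE.isLeaf_iff.1 hv).1) (by simpa using hi0)
      obtain rfl : i = 3 := by
        rw [inr_mem_extend, Set.mem_insert_iff, Set.mem_singleton_iff] at hi
        omega
      rfl
  link := by
    rintro (c | i) hc (d | j) hd hcd <;>
      simp only [inl_mem_extend, inr_mem_extend, Set.mem_insert_iff, Set.mem_singleton_iff,
        attachPath_inl_inl, attachPath_inl_inr, attachPath_inr_inl, attachPath_inr_inr]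
        at hc hd hcd
    · exact h.link c hc d hd hcd
    · obtain ⟨rfl, hj⟩ := hcd
      obtain rfl : j = 0 := Fin.ext hj
      simp [h.leaf _ hv]
    · obtain ⟨rfl, hi⟩ := hcd
      obtain rfl : i = 0 := Fin.ext hi
      simp [h.leaf _ hv]
    · omega

theorem SmallEnd.inl (h : SmallEnd G E v) {w : V} (hne : v ≠ w) {F : Set (Fin k)} :
    SmallEnd (attachPath G w k) (extend E F) (.inl v) := by
  rintro (x | i) ⟨hx, hvx⟩ (y | j) ⟨hy, hvy⟩
  · exact congrArg _ (h ⟨by simpa using hx, hvx⟩ ⟨by simpa using hy, hvy⟩)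
  · exact absurd hvy.1 hne
  · exact absurd hvx.1 hne
  · exact absurd hvx.1 hne

theorem IsTight.attach_two (h : IsTight G E) {c d e : V} (hv : v ∈ E) (hc : c ∉ E) (hd : d ∉ E)
    (he : e ∈ E) (hvc : G.Adj v c) (hcd : G.Adj c d) (hde : G.Adj d e) (hs : SmallEnd G E e) :
    IsTight (attachPath G v 2) (extend E {0}) where
  toIsEndSet := h.toIsEndSet.attach_two hv
  exists_small := by
    have mate_v : ∀ x ∉ E, G.Adj v x → x = c := fun x hx hvx =>
      (h.existsUnique_mate v).unique ⟨hvx, by simp [hx, hv]⟩ ⟨hvc, by simp [hc, hv]⟩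
    have hev : e ≠ v := by
      rintro rfl
      exact hcd.ne' (mate_v d hd hde.symm)
    rintro (a | i) ha
    · rw [inl_mem_extend] at ha
      obtain ⟨d', hd', had', e', he', hde', hs'⟩ := h.exists_small a ha
      by_cases hev' : e' = v
      · subst hev'
        obtain rfl := mate_v d' hd' hde'.symm
        -- The piece of `a` is the path `v c d e`, whose other end `e` stays small.
        have had : d = a ∨ G.Adj a d := by
          rcases had' with rfl | had'
          · exact .inr hcd
          · exact .inl (h.inner_unique d' hd' d hd a ha hcd had'.symm)
        exact ⟨.inl d, by simpa using hd, had.imp (congrArg _) id, .inl e, by simpa using he,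
          hde, hs.inl hev⟩
      · exact ⟨.inl d', by simpa using hd', had'.imp (congrArg _) id, .inl e', by simpa using he',
          hde', hs'.inl hev'⟩
    · obtain rfl : i = 1 := by
        rw [inr_mem_extend, Set.mem_singleton_iff] at ha
        omega
      refine ⟨_, ha, .inl rfl, .inr 0, by simp, by simp, ?_⟩
      rintro (x | i) ⟨hx, hix⟩ (y | j) ⟨hy, hjy⟩ <;>
        simp only [inr_mem_extend, Set.mem_singleton_iff, attachPath_inr_inl,
          attachPath_inr_inr] at *
      · rw [hix.1, hjy.1]
      all_goals omega

theorem IsTight.attach_four (h : IsTight G E) (hv : IsLeaf G v) :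
    IsTight (attachPath G v 4) (extend E {1, 2}) where
  toIsEndSet := h.toIsEndSet.attach_four hv
  exists_small := by
    have small_inr : ∀ i : Fin 4, i.val ≠ 0 →
        SmallEnd (attachPath G v 4) (extend E {1, 2}) (.inr i) := by
      rintro i hi (x | a) ⟨hx, hix⟩ (y | b) ⟨hy, hiy⟩ <;>
        simp only [inr_mem_extend, Set.mem_singleton_iff, Set.mem_insert_iff,
          attachPath_inr_inl, attachPath_inr_inr] at *
      · rw [hix.1, hiy.1]
      · omega
      · omega
      · congr 1
        omega
    rintro (a | i) ha
    · obtain ⟨d, hd, had, e, he, hde, hs⟩ := h.exists_small a (by simpa using ha)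
      have hev : e ≠ v := fun hev => (h.isLeaf_iff.1 hv).1 (hev ▸ he)
      exact ⟨.inl d, by simpa using hd, had.imp (congrArg _) id, .inl e, by simpa using he,
        hde, hs.inl hev⟩
    · obtain rfl | rfl : i = 0 ∨ i = 3 := by
        rw [inr_mem_extend, Set.mem_insert_iff, Set.mem_singleton_iff] at ha
        omega
      · exact ⟨_, ha, .inl rfl, .inr 1, by simp, by simp, small_inr 1 (by simp)⟩
      · exact ⟨_, ha, .inl rfl, .inr 2, by simp, by simp, small_inr 2 (by simp)⟩

theorem IsEndSet.smallEnd_iff_deg_eq_two (h : IsEndSet G E) (hv : v ∈ E) :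
    SmallEnd G E v ↔ deg G v = 2 := by
  have hm := h.adj_mate v
  have hmE := h.mate_notMem hv
  constructor
  · intro hs
    obtain ⟨y, hy, hvy⟩ := h.exists_adj_end v hv
    refine Set.ncard_eq_two.2 ⟨h.mate v, y, fun hmy => hmE (hmy ▸ hy), Set.ext fun z => ?_⟩
    refine ⟨fun hz => ?_, by rintro (rfl | rfl) <;> assumption⟩
    by_cases hzE : z ∈ E
    · exact .inr (hs ⟨hzE, hz⟩ ⟨hy, hvy⟩)
    · exact .inl (h.eq_mate hz (by simp [hzE, hv]))
  · intro hdeg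
    obtain ⟨x, y, -, hxy⟩ := Set.ncard_eq_two.1 hdeg
    have mem_pair {z : V} (hz : G.Adj v z) : z = x ∨ z = y := hxy.subset hz
    rintro a ⟨haE, ha⟩ b ⟨hbE, hb⟩
    grind [mem_pair hm, mem_pair ha, mem_pair hb]

theorem adj_of_pathGraph_four (f : SimpleGraph.pathGraph 4 ↪g G) :
    G.Adj (f 0) (f 1) ∧ G.Adj (f 1) (f 2) ∧ G.Adj (f 2) (f 3) := by
  simp [f.map_adj_iff, SimpleGraph.pathGraph_adj]

theorem Generated.exists_isTight {V : Type*} {G : SimpleGraph V} {S : V → Status} {P : Set V}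
    (h : Generated G S P) : ∃ E, IsTight G E ∧ Labeled G S E := by
  induction h with
  | base G e =>
    exact ⟨_, isTight_pathGraph_four.preimage e.symm, labeled_pathGraph_four.preimage e.symm⟩
  | op2 v _ hv hw ih =>
    obtain ⟨E, hE, hS⟩ := ih
    have mem := fun {x} => hS.mem_iff hE.toIsEndSet (x := x)
    have notMem := fun {x} => hS.notMem_iff hE.toIsEndSet (x := x)
    obtain ⟨w, ⟨-, f, rfl, rfl, h0, h1, h2⟩, hdeg⟩ := hw
    obtain ⟨h01, h12, h23⟩ := adj_of_pathGraph_four f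
    have h0E := mem.2 (.inl h0)
    exact ⟨_, hE.attach_two (mem.2 (.inr hv)) (notMem.2 (.inr h2)) (notMem.2 (.inl h1)) h0E
      h23.symm h12.symm h01.symm ((hE.smallEnd_iff_deg_eq_two h0E).2 hdeg),
      hS.attach_two hE.toIsEndSet (mem.2 (.inr hv))⟩
  | op3 v _ _ hdeg ih =>
    obtain ⟨E, hE, hS⟩ := ih
    exact ⟨_, hE.attach_four hdeg, hS.attach_four hE.toIsEndSet hdeg⟩
  | op4 v _ _ hv hw ih =>
    obtain ⟨E, hE, hS⟩ := ih
    have mem := fun {x} => hS.mem_iff hE.toIsEndSet (x := x)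
    have notMem := fun {x} => hS.notMem_iff hE.toIsEndSet (x := x)
    obtain ⟨w, ⟨-, -, -, f, rfl, rfl, h1, h2, h3⟩, hdeg⟩ := hw
    obtain ⟨h01, h12, h23⟩ := adj_of_pathGraph_four f
    have h3E := mem.2 (.inr h3)
    exact ⟨_, hE.attach_two (mem.2 (.inl hv)) (notMem.2 (.inl h1)) (notMem.2 (.inr h2)) h3E
      h01 h12 h23 ((hE.smallEnd_iff_deg_eq_two h3E).2 hdeg),
      hS.attach_two hE.toIsEndSet (mem.2 (.inl hv))⟩
  | iso e _ ih =>
    obtain ⟨E, hE, hS⟩ := ih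
    exact ⟨_, hE.preimage e.symm, hS.preimage e.symm⟩

end

/-! ### Growing trees with small ends -/

section

variable {V W : Type*} {T : SimpleGraph V} {G : SimpleGraph W} {v : W} {x y z w : V}

theorem exists_embedding_of_injective (hT : T.IsAcyclic) (hG : G.Connected) (f : G →g T)
    (hf : Function.Injective f) : ∃ ψ : G ↪g T, ∀ a, ψ a = f a := by
  refine ⟨⟨⟨f, hf⟩, fun {a b} => ⟨fun hab => ?_, f.map_adj⟩⟩, fun _ => rfl⟩
  obtain ⟨p, hp⟩ := hG.exists_isPath a b
  have hlength : (p.map f).length = 1 := congrArg SimpleGraph.Walk.length <| Subtype.mk.inj <|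
    (hT.subsingleton_path _ _).elim ⟨_, hp.map hf⟩ (SimpleGraph.Path.singleton hab)
  rw [SimpleGraph.Walk.length_map] at hlength
  exact SimpleGraph.Walk.adj_of_length_eq_one hlength

theorem exists_embedding_attach_one (hT : T.IsAcyclic) (hG : G.Connected) (ι : G ↪g T)
    (hadj : T.Adj (ι v) x) (hx : x ∉ Set.range ι) :
    ∃ ψ : attachPath G v 1 ↪g T, (∀ a, ψ (.inl a) = ι a) ∧ ψ (.inr 0) = x := by
  let f : attachPath G v 1 →g T := ⟨Sum.elim ι fun _ => x, by
    rintro (a | i) (b | j) hab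
    · exact ι.map_adj_iff.2 hab
    · exact hab.1 ▸ hadj
    · exact (hab.1 ▸ hadj).symm
    · exact absurd (congrArg Sum.inr (Subsingleton.elim i j)) hab.ne⟩
  obtain ⟨ψ, hψ⟩ := exists_embedding_of_injective hT (connected_attachPath hG v 1) f <|
    ι.injective.sumElim (Function.injective_of_subsingleton _) fun a _ ha => hx ⟨a, ha⟩
  exact ⟨ψ, fun a => hψ _, hψ _⟩

theorem exists_embedding_attach_two (hT : T.IsAcyclic) (hG : G.Connected) (ι : G ↪g T)
    (hvx : T.Adj (ι v) x) (hx : x ∉ Set.range ι) (hxy : T.Adj x y) (hy : y ≠ ι v) :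
    ∃ ψ : attachPath G v 2 ↪g T,
      (∀ a, ψ (.inl a) = ι a) ∧ ψ (.inr 0) = x ∧ ψ (.inr 1) = y := by
  obtain ⟨φ, hφ, rfl⟩ := exists_embedding_attach_one hT hG ι hvx hx
  have hyφ : y ∉ Set.range φ := by
    rintro ⟨a | i, rfl⟩
    · obtain ⟨rfl, -⟩ := attachPath_inr_inl.1 (φ.map_adj_iff.1 hxy)
      exact hy (hφ a)
    · exact hxy.ne (congrArg (φ ∘ Sum.inr) (Subsingleton.elim 0 i))
  obtain ⟨ψ, hψ, rfl⟩ :=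
    exists_embedding_attach_one hT (connected_attachPath hG v 1) φ hxy hyφ
  exact ⟨(attachAppend G v 0 1).symm.toEmbedding.trans ψ, fun a => (hψ _).trans (hφ a), hψ _, rfl⟩

theorem exists_embedding_attach_four (hT : T.IsAcyclic) (hG : G.Connected) (ι : G ↪g T)
    (hvx : T.Adj (ι v) x) (hx : x ∉ Set.range ι) (hxy : T.Adj x y) (hy : y ≠ ι v)
    (hyz : T.Adj y z) (hz : z ≠ x) (hzw : T.Adj z w) (hw : w ≠ y) :
    ∃ ψ : attachPath G v 4 ↪g T, (∀ a, ψ (.inl a) = ι a) ∧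
      ψ (.inr 0) = x ∧ ψ (.inr 1) = y ∧ ψ (.inr 2) = z ∧ ψ (.inr 3) = w := by
  obtain ⟨φ, hφ, rfl, rfl⟩ := exists_embedding_attach_two hT hG ι hvx hx hxy hy
  have hzφ : z ∉ Set.range φ := by
    rintro ⟨a | i, rfl⟩
    · simpa using attachPath_inr_inl.1 (φ.map_adj_iff.1 hyz)
    · have hi : i ≠ 0 := by rintro rfl; exact hz rfl
      have hadj := φ.map_adj_iff.1 hyz
      rw [attachPath_inr_inr] at hadj
      omega
  obtain ⟨ψ, hψ, rfl, rfl⟩ :=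
    exists_embedding_attach_two hT (connected_attachPath hG v 2) φ hyz hzφ hzw hw
  exact ⟨(attachAppend G v 1 2).symm.toEmbedding.trans ψ, fun a => (hψ _).trans (hφ a), hψ _, hψ _,
    rfl, rfl⟩

theorem exists_embedding_pathGraph_four (hT : T.IsAcyclic) (hxy : T.Adj x y) (hyz : T.Adj y z)
    (hzw : T.Adj z w) (hxz : x ≠ z) (hyw : y ≠ w) :
    ∃ φ : SimpleGraph.pathGraph 4 ↪g T, φ 0 = x ∧ φ 1 = y ∧ φ 2 = z ∧ φ 3 = w := by
  have h1 := hxy.ne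
  have h2 := hyz.ne
  have h3 := hzw.ne
  have hxw : x ≠ w := by
    rintro rfl
    have hp : (SimpleGraph.Walk.cons hxy (.cons hyz .nil)).IsPath := by simp [h1, h2, hxz]
    have heq := (hT.subsingleton_path _ _).elim ⟨_, hp⟩ (SimpleGraph.Path.singleton hzw.symm)
    exact absurd (congrArg SimpleGraph.Walk.length (Subtype.mk.inj heq)) (by simp)
  let f : SimpleGraph.pathGraph 4 →g T := ⟨![x, y, z, w], by
    intro i j hij
    rw [SimpleGraph.pathGraph_adj] at hij
    fin_cases i <;> fin_cases j <;> simp_all [T.adj_comm]⟩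
  obtain ⟨φ, hφ⟩ := exists_embedding_of_injective hT (SimpleGraph.pathGraph_connected 3) f <| by
    intro i j hij
    change (![x, y, z, w] : Fin 4 → V) i = ![x, y, z, w] j at hij
    fin_cases i <;> fin_cases j <;> simp_all
  exact ⟨φ, hφ 0, hφ 1, hφ 2, hφ 3⟩

end

section

variable {V : Type u} {T : SimpleGraph V} {E : Set V}

theorem IsTight.exists_small_of_not_smallEnd (h : IsTight T E) {z : V} (hz : z ∈ E)
    (hzs : ¬ SmallEnd T E z) :
    ∃ d ∉ E, T.Adj (h.mate z) d ∧ ∃ e ∈ E, T.Adj d e ∧ SmallEnd T E e := by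
  obtain ⟨d, hd, rfl | hcd, e, he, hde, hs⟩ := h.exists_small _ (h.mate_notMem hz)
  · have hez : e = z := by
      rw [h.eq_mate hde (by simp [hd, he]), h.mate_mate]
    exact absurd (hez ▸ hs) hzs
  · exact ⟨d, hd, hcd, e, he, hde, hs⟩

/-- Otherwise one can walk away from a fixed end forever: from an end `z` that is not small through
its piece to the other end `e`, which is small, and on to a neighbour `y` of `e`, which is not. -/
theorem IsTight.exists_adj_smallEnd [Finite V] (hT : T.IsTree) (h : IsTight T E) :
    ∃ x ∈ E, ∃ y ∈ E, T.Adj x y ∧ SmallEnd T E x ∧ SmallEnd T E y := by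
  by_contra! hno
  obtain ⟨r, hr, hrs⟩ : ∃ r ∈ E, ¬ SmallEnd T E r := by
    obtain ⟨v⟩ := hT.connected.nonempty
    obtain ⟨e, he⟩ : E.Nonempty := by
      by_cases hv : v ∈ E
      exacts [⟨v, hv⟩, ⟨_, h.mate_mem_iff.2 hv⟩]
    obtain ⟨y, hy, hey⟩ := h.exists_adj_end e he
    by_cases hs : SmallEnd T E e
    exacts [⟨y, hy, hno e he y hy hey hs⟩, ⟨e, he, hs⟩]
  obtain ⟨z, ⟨hz, hzs, hzd⟩, hmax⟩ := Set.exists_max_image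
    {z | z ∈ E ∧ ¬ SmallEnd T E z ∧ T.dist r (h.mate z) = T.dist r z + 1} (T.dist r)
    (Set.toFinite _)
    ⟨r, hr, hrs, by rw [SimpleGraph.dist_self, SimpleGraph.dist_eq_one_iff_adj.2 (h.adj_mate r)]⟩
  obtain ⟨d, hd, hcd, e, he, hde, hes⟩ := h.exists_small_of_not_smallEnd hz hzs
  obtain ⟨y, hy, hey⟩ := h.exists_adj_end e he
  have hc := h.mate_notMem hz
  have step {p v x : V} (hvp : T.Adj v p) (hdist : T.dist r v = T.dist r p + 1)
      (hvx : T.Adj v x) (hxp : x ≠ p) : T.dist r x = T.dist r v + 1 :=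
    dist_eq_add_one_of_adj_of_ne hT hvp hdist hvx hxp
  have hdist_d := step (h.adj_mate z).symm hzd hcd fun hdz => hd (hdz ▸ hz)
  have hdist_e := step hcd.symm hdist_d hde fun hec => hc (hec ▸ he)
  have hdist_y := step hde.symm hdist_e hey fun hyd => hd (hyd ▸ hy)
  have hdist_mate := step hey.symm hdist_y (h.adj_mate y) fun hme => h.mate_notMem hy (hme ▸ he)
  have := hmax y ⟨hy, hno e he y hy hey hes, hdist_mate⟩
  omega

/-- A labeled tree generated so far, embedded in `T` by `ι` compatibly with the end set `E`, and
such that the ends on its basic path are already small in `T`. -/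
structure Grown (T : SimpleGraph V) (E : Set V) {W : Type u} (G : SimpleGraph W)
    (S : W → Status) (P : Set W) (ι : G ↪g T) : Prop where
  generated : Generated G S P
  connected : G.Connected
  isEndSet : IsEndSet G (ι ⁻¹' E)
  labeled : Labeled G S (ι ⁻¹' E)
  small : ∀ a ∈ P, ι a ∈ E → SmallEnd T E (ι a)

theorem exists_grown [Finite V] (hT : T.IsTree) (h : IsTight T E) :
    ∃ (W : Type u) (G : SimpleGraph W) (S : W → Status) (P : Set W) (ι : G ↪g T),
      Grown T E G S P ι := by
  obtain ⟨x, hx, y, hy, hxy, hxs, hys⟩ := h.exists_adj_smallEnd hT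
  have hmx := h.mate_notMem hx
  have hmy := h.mate_notMem hy
  obtain ⟨ψ, h0, h1, h2, h3⟩ := exists_embedding_pathGraph_four hT.isAcyclic (h.adj_mate x).symm
    hxy (h.adj_mate y) (fun hmate => hmx (hmate ▸ hy)) (fun hmate => hmy (hmate ▸ hx))
  let e : SimpleGraph.pathGraph 4 ≃g T.induce (Set.range ψ) :=
    ⟨Equiv.ofInjective ψ ψ.injective, ψ.map_adj_iff⟩
  let ι : T.induce (Set.range ψ) ↪g T := SimpleGraph.Embedding.induce _
  have hι (i : Fin 4) : ι (e i) = ψ i := rfl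
  have hE : ι ⁻¹' E = e.symm ⁻¹' {1, 2} := by
    ext a
    obtain ⟨i, rfl⟩ := e.surjective a
    rw [Set.mem_preimage, Set.mem_preimage, hι, e.symm_apply_apply]
    fin_cases i <;> simp [*]
  refine ⟨_, _, _, _, ι, .base _ e, ?_, ?_, ?_, ?_⟩
  · exact e.connected_iff.1 (SimpleGraph.pathGraph_connected 3)
  · exact hE ▸ isEndSet_pathGraph_four.preimage e.symm
  · exact hE ▸ labeled_pathGraph_four.preimage e.symm
  · intro a _ ha
    obtain ⟨i, rfl⟩ := e.surjective a
    rw [hι] at ha ⊢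
    fin_cases i <;> simp_all

theorem IsEndSet.map_mate (hE : IsEndSet T E) {W : Type*} {G : SimpleGraph W} (ι : G ↪g T)
    (h : IsEndSet G (ι ⁻¹' E)) (a : W) : ι (h.mate a) = hE.mate (ι a) :=
  hE.eq_mate (ι.map_adj_iff.2 (h.adj_mate a)) h.mate_mem_iff

variable {W : Type u} {G : SimpleGraph W} {S : W → Status} {P : Set W} {ι : G ↪g T}

theorem Generated.attach_two (hgen : Generated G S P) (hG : G.IsAcyclic) {F : Set W}
    (hF : IsEndSet G F) (hS : Labeled G S F) {a c d e : W} (ha : a ∈ F) (hc : c ∉ F) (hd : d ∉ F)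
    (he : e ∈ F) (hac : G.Adj a c) (hcd : G.Adj c d) (hde : G.Adj d e) (hs : SmallEnd G F e)
    (haP : a ∉ P) : Generated (attachPath G a 2) (Sum.elim S ![Status.A, .C]) (Sum.inl '' P) := by
  have had : a ≠ d := fun had => hd (had ▸ ha)
  have hce : c ≠ e := fun hce => hc (hce ▸ he)
  have hdeg := (hF.smallEnd_iff_deg_eq_two he).1 hs
  have hlink := hS.link c hc d hd hcd
  rcases hS.pair a ha c hc hac with ⟨hSa, hSc⟩ | ⟨hSa, hSc⟩
  · obtain ⟨hSe, hSd⟩ := (hS.pair e he d hd hde.symm).resolve_left fun hS' =>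
      hlink (hSc.trans hS'.2.symm)
    have hsupport : ¬ IsSupport G a := by
      rintro ⟨y, hay, hy⟩
      obtain ⟨hyF, hyd⟩ := hF.isLeaf_iff.1 hy
      have hyc : y = c := (hF.existsUnique_mate a).unique ⟨hay, by simp [hyF, ha]⟩
        ⟨hac, by simp [hc, ha]⟩
      exact hyd d hd (hyc ▸ hcd)
    obtain ⟨φ, h0, h1, h2, h3⟩ := exists_embedding_pathGraph_four hG hac hcd hde had hce
    exact .op4 a hgen haP hSa
      ⟨e, ⟨hsupport, haP, hSa, φ, h0, h3, h1 ▸ hSc, h2 ▸ hSd, hSe⟩, hdeg⟩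
  · obtain ⟨hSe, hSd⟩ := (hS.pair e he d hd hde.symm).resolve_right fun hS' =>
      hlink (hSc.trans hS'.2.symm)
    obtain ⟨φ, h0, h1, h2, h3⟩ :=
      exists_embedding_pathGraph_four hG hde.symm hcd.symm hac.symm hce.symm had.symm
    exact .op2 a hgen hSa ⟨e, ⟨hSa, φ, h0, h3, hSe, h1 ▸ hSd, h2 ▸ hSc⟩, hdeg⟩

namespace Grown

theorem exists_attach_two (hT : T.IsAcyclic) (hE : IsEndSet T E) (h : Grown T E G S P ι) {a : W}
    {x : V} (ha : ι a ∈ E) (hx : x ∈ E) (hax : T.Adj (ι a) x) (hxι : x ∉ Set.range ι)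
    (hgen : Generated (attachPath G a 2) (Sum.elim S ![Status.A, .C]) (Sum.inl '' P)) :
    ∃ ψ : attachPath G a 2 ↪g T,
      Grown T E (attachPath G a 2) (Sum.elim S ![Status.A, .C]) (Sum.inl '' P) ψ := by
  have hmate := hE.mate_notMem hx
  obtain ⟨ψ, hψ, h0, h1⟩ := exists_embedding_attach_two hT h.connected ι hax hxι (hE.adj_mate x)
    (fun hma => hmate (hma ▸ ha))
  have hpre : ψ ⁻¹' E = extend (ι ⁻¹' E) {0} := by
    ext (b | i)
    · simp [hψ]
    · fin_cases i <;> simp [*]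
  refine ⟨ψ, hgen, connected_attachPath h.connected a 2, hpre ▸ h.isEndSet.attach_two ha,
    hpre ▸ h.labeled.attach_two h.isEndSet ha, ?_⟩
  rintro _ ⟨b, hb, rfl⟩ hbE
  rw [hψ] at hbE ⊢
  exact h.small b hb hbE

theorem exists_attach_four (hT : T.IsAcyclic) (hE : IsEndSet T E) (h : Grown T E G S P ι) {a : W}
    {d : V} (ha : ι a ∉ E) (hd : d ∉ E) (had : T.Adj (ι a) d) (hdι : d ∉ Set.range ι) :
    ∃ ψ : attachPath G a 4 ↪g T,
      Grown T E (attachPath G a 4) (Sum.elim S ![Status.D, .B, .A, .C]) (Sum.inl '' P) ψ := by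
  have hleaf : IsLeaf G a := h.isEndSet.isLeaf_iff.2 ⟨ha, fun b hb hab =>
    hdι ⟨b, hE.inner_unique _ ha _ hb _ hd (ι.map_adj_iff.2 hab) had⟩⟩
  have he : hE.mate d ∈ E := hE.mate_mem_iff.2 hd
  obtain ⟨x, hx, hex⟩ := hE.exists_adj_end _ he
  have hmate := hE.mate_notMem hx
  obtain ⟨ψ, hψ, h0, h1, h2, h3⟩ := exists_embedding_attach_four hT h.connected ι had hdι
    (hE.adj_mate d) (fun hea => ha (hea ▸ he)) hex (fun hxd => hd (hxd ▸ hx)) (hE.adj_mate x)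
    (fun hme => hmate (hme ▸ he))
  have hpre : ψ ⁻¹' E = extend (ι ⁻¹' E) {1, 2} := by
    ext (b | i)
    · simp [hψ]
    · fin_cases i <;> simp [*]
  refine ⟨ψ, .op3 a h.generated (h.labeled.leaf a hleaf) hleaf,
    connected_attachPath h.connected a 4, hpre ▸ h.isEndSet.attach_four hleaf,
    hpre ▸ h.labeled.attach_four h.isEndSet hleaf, ?_⟩
  rintro _ ⟨b, hb, rfl⟩ hbE
  rw [hψ] at hbE ⊢
  exact h.small b hb hbE

theorem exists_adj_notMem_range (hT : T.Connected) (h : Grown T E G S P ι)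
    (hι : ¬ Function.Surjective ι) : ∃ a, ∃ x ∉ Set.range ι, T.Adj (ι a) x := by
  obtain ⟨y, hy⟩ := not_forall.1 hι
  obtain ⟨b⟩ := h.connected.nonempty
  obtain ⟨p⟩ := hT.preconnected (ι b) y
  obtain ⟨d, -, ⟨a, ha⟩, hd⟩ := p.exists_boundary_dart (Set.range ι) ⟨b, rfl⟩ hy
  exact ⟨a, d.snd, hd, ha ▸ d.adj⟩

/-- If the tree grown so far can be left at an end `a`, then `a` is not small in `T`, so the other
end of its piece is, and that piece is used for `𝒪₂` or `𝒪₄`; a piece that sticks out of the grown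
tree is added by `𝒪₃`. -/
theorem exists_larger (hT : T.IsTree) (hE : IsTight T E) (h : Grown T E G S P ι)
    (hι : ¬ Function.Surjective ι) :
    ∃ (k : ℕ) (_ : 0 < k) (a : W) (S' : W ⊕ Fin k → Status) (P' : Set (W ⊕ Fin k))
      (ψ : attachPath G a k ↪g T), Grown T E (attachPath G a k) S' P' ψ := by
  obtain ⟨a, x, hx, hax⟩ := h.exists_adj_notMem_range hT.connected hι
  have hxa : x ∈ E ↔ ι a ∈ E := by
    by_contra hne
    exact hx ⟨_, (hE.map_mate ι h.isEndSet a).trans (hE.eq_mate hax (by tauto)).symm⟩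
  have extend_four {c : W} {d : V} (hc : ι c ∉ E) (hd : d ∉ E) (hcd : T.Adj (ι c) d)
      (hdι : d ∉ Set.range ι) := h.exists_attach_four hT.isAcyclic hE.toIsEndSet hc hd hcd hdι
  by_cases ha : ι a ∈ E
  · have hbig : ¬ SmallEnd T E (ι a) := fun hs => by
      obtain ⟨y, hy, hay⟩ := h.isEndSet.exists_adj_end a ha
      exact hx ⟨y, hs ⟨hy, ι.map_adj_iff.2 hay⟩ ⟨hxa.2 ha, hax⟩⟩
    obtain ⟨d, hd, hcd, e, he, hde, hs⟩ := hE.exists_small_of_not_smallEnd ha hbig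
    rw [← hE.map_mate ι h.isEndSet] at hcd
    have hc := h.isEndSet.mate_notMem ha
    by_cases hdι : d ∈ Set.range ι
    · obtain ⟨d, rfl⟩ := hdι
      obtain rfl : ι (h.isEndSet.mate d) = e := by
        rw [hE.map_mate ι h.isEndSet, ← hE.eq_mate hde (by simp [hd, he])]
      have hgen := h.generated.attach_two (hT.isAcyclic.embedding ι) h.isEndSet h.labeled ha hc hd
        he (h.isEndSet.adj_mate a) (ι.map_adj_iff.1 hcd) (ι.map_adj_iff.1 hde) (hs.preimage ι)
        fun haP => hbig (h.small a haP ha)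
      obtain ⟨ψ, hψ⟩ := h.exists_attach_two hT.isAcyclic hE.toIsEndSet ha (hxa.2 ha) hax hx hgen
      exact ⟨2, by norm_num, a, _, _, ψ, hψ⟩
    · obtain ⟨ψ, hψ⟩ := extend_four hc hd hcd hdι
      exact ⟨4, by norm_num, _, _, _, ψ, hψ⟩
  · obtain ⟨ψ, hψ⟩ := extend_four ha (mt hxa.1 ha) hax hx
    exact ⟨4, by norm_num, a, _, _, ψ, hψ⟩

theorem exists_familyT2 {V : Type u} [Finite V] {T : SimpleGraph V} {E : Set V} (hT : T.IsTree)
    (hE : IsTight T E) {W : Type u} {G : SimpleGraph W} {S : W → Status} {P : Set W} {ι : G ↪g T}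
    (h : Grown T E G S P ι) : ∃ S : V → Status, FamilyT2 T S := by
  have := Finite.of_injective ι ι.injective
  by_cases hι : Function.Surjective ι
  · let e : G ≃g T := ⟨Equiv.ofBijective ι ⟨ι.injective, hι⟩, ι.map_rel_iff'⟩
    exact ⟨_, _, .iso e h.generated⟩
  · obtain ⟨k, hk, a, S', P', ψ, hψ⟩ := h.exists_larger hT hE hι
    have : Nat.card V - Nat.card (W ⊕ Fin k) < Nat.card V - Nat.card W := by
      have hcard := Nat.card_le_card_of_injective ψ ψ.injective
      rw [Nat.card_sum, Nat.card_fin] at hcard ⊢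
      omega
    exact hψ.exists_familyT2 hT hE
termination_by Nat.card V - Nat.card W

end Grown

theorem IsTight.exists_familyT2 [Finite V] (hT : T.IsTree) (h : IsTight T E) :
    ∃ S : V → Status, FamilyT2 T S := by
  obtain ⟨_, _, _, _, _, hgrown⟩ := exists_grown hT h
  exact hgrown.exists_familyT2 hT h

end

end DisjDom

theorem theorem2p4 {V : Type*} [Fintype V] [Nontrivial V] (T : SimpleGraph V) (hT : T.IsTree) :
    (DisjDom.disjDomNumber T : ℚ) ≤
        ((Fintype.card V : ℚ) + DisjDom.numLeaves T + DisjDom.numSupports T) / 4 ∧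
      ((DisjDom.disjDomNumber T : ℚ) =
          ((Fintype.card V : ℚ) + DisjDom.numLeaves T + DisjDom.numSupports T) / 4 ↔
        ∃ S : V → DisjDom.Status, DisjDom.FamilyT2 T S) := by
  obtain ⟨hle, heq⟩ := DisjDom.bound_of_isTree V T hT
  have hweight : (Fintype.card V : ℚ) + DisjDom.numLeaves T + DisjDom.numSupports T =
      (DisjDom.weight T : ℚ) := by
    simp [DisjDom.weight, Nat.card_eq_fintype_card]
  rw [hweight, le_div_iff₀ (by norm_num), eq_div_iff (by norm_num), mul_comm]
  norm_cast
  refine ⟨hle, fun h => ?_, fun ⟨S, P, hgen⟩ => ?_⟩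
  · obtain ⟨E, hE⟩ := heq h
    exact (hE.isTight_of_weight_le hT h.ge).exists_familyT2 hT
  · obtain ⟨E, hE, -⟩ := hgen.exists_isTight
    exact hle.antisymm hE.weight_le
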